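/- Let $V$ be a finite-dimensional complex vector space, $\mathcal A$ a finite set of nonzero linear subspaces of $V$, and $X$ the set of all sums of nonempty subfamilies of $\mathcal A$, ordered by inclusion. Let $P=\mathbb Q[c_A : A\in X]$, let $\Lambda$ be the exterior algebra over $\mathbb Q$ with generators $e_A$, $A\in X$, and grade $P\otimes\Lambda$ by $\deg c_A=2$, $\deg e_A=1$. Let $J\subseteq P\otimes\Lambda$ be the two-sided (homogeneous) ideal generated by all elements $$\prod_{A\in X_1}e_A\ \prod_{A\in X_2}c_A\ \Bigl(\sum_{C\in X,\ C\supseteq B}c_C\Bigr)^{d},\qquad d=\dim B-\dim\sum_{A\in X_1\cup X_2}A,$$ where $B\in X$ and $X_1,X_2\subseteq X$ are such that every $A\in X_1\cup X_2$ is strictly contained in $B$ (the first product is taken in any linear order on $X_1$; it matters only up to sign). Put $M=(P\otimes\Lambda)/J$, let $M_r$ be its component of degree $r$, and for $A\in X$ let $$\sigma_A=\sum_{B\in X,\ B\supseteq A}c_B,\qquad \tau_A=\sum_{B\in X,\ B\supseteq A}e_B\qquad\text{in } M .$$ Fix an integer $r\ge 0$. Consider all triples $(S,T,m)$ where $S,T\subseteq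 X$, the set $S\cup T$ is a flag (totally ordered by inclusion), and $m:S\to\mathbb Z_{>0}$ satisfies $m(A)<\dim A-\dim A'$ for every $A\in S$ and $|T|+2\sum_{A\in S}m(A)=r$; here $A'$ is the predecessor of $A$ in $S\cup T$, and $A'=0$ if $A$ is the smallest element of $S\cup T$. Then the monomials $$\mu(S,T,m)=\prod_{B\in T}\tau_B\ \prod_{A\in S}\sigma_A^{m(A)},$$ with the first product taken in increasing order of inclusion, are pairwise distinct for distinct triples and form a basis of the $\mathbb Q$-vector space $M_r$. -/

import Mathlib

open scoped TensorProduct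

noncomputable section

namespace SubspaceModel

variable {V : Type*} [AddCommGroup V] [Module ℂ V]

open scoped Classical in
/-- The set of all sums of nonempty subfamilies of a finite set `𝒜` of subspaces. As a type it is
ordered by inclusion. -/
def sums (𝒜 : Finset (Submodule ℂ V)) : Finset (Submodule ℂ V) :=
  (𝒜.powerset.filter Finset.Nonempty).image fun F => F.sup id

/-- The polynomial algebra over `ℚ` with an indeterminate for each `A ∈ X`. -/
abbrev Poly (X : Finset (Submodule ℂ V)) : Type _ := MvPolynomial X ℚ

/-- The exterior algebra over `ℚ` with a generator for each `A ∈ X`. -/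
abbrev Ext (X : Finset (Submodule ℂ V)) : Type _ := ExteriorAlgebra ℚ (X →₀ ℚ)

/-- The exterior generator of `A`. -/
def extGen {X : Finset (Submodule ℂ V)} (A : X) : Ext X :=
  ExteriorAlgebra.ι ℚ (Finsupp.single A 1)

open scoped Classical in
/-- The number `d(Y, B) = dim B - dim (∑_{A ∈ Y} A)`. -/
def defect {X : Finset (Submodule ℂ V)} (Y : Finset X) (B : X) : ℕ :=
  Module.finrank ℂ (B : Submodule ℂ V) -
    Module.finrank ℂ (Y.sup fun A => (A : Submodule ℂ V) : Submodule ℂ V)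

open scoped Classical in
/-- The element `∏_{A ∈ X₁} e_A ∏_{A ∈ X₂} c_A (∑_{C ⊇ B} c_C) ^ d(X₁ ∪ X₂, B)` of the tensor product
of the polynomial and the exterior algebra; the linear order on `X₁` is that of a list. -/
def relator {X : Finset (Submodule ℂ V)} (X₁ : List X) (X₂ : Finset X) (B : X) :
    Poly X ⊗[ℚ] Ext X :=
  ((∏ A ∈ X₂, MvPolynomial.X A) *
      (∑ C with B ≤ C, MvPolynomial.X C) ^ defect (X₁.toFinset ∪ X₂) B) ⊗ₜ[ℚ]
    (X₁.map extGen).prod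

/-- All the relators, for `X₁, X₂ ⊆ X` and `B ∈ X` such that `B` strictly contains every element of
`X₁ ∪ X₂`. -/
def relators (X : Finset (Submodule ℂ V)) : Set (Poly X ⊗[ℚ] Ext X) :=
  {x | ∃ (X₁ : List X) (X₂ : Finset X) (B : X), X₁.Nodup ∧ (∀ A ∈ X₁, A < B) ∧
    (∀ A ∈ X₂, A < B) ∧ x = relator X₁ X₂ B}

/-- The two-sided ideal generated by the relators. -/
def modelIdeal (X : Finset (Submodule ℂ V)) : Ideal (Poly X ⊗[ℚ] Ext X) :=
  TwoSidedIdeal.asIdeal (TwoSidedIdeal.span (relators X))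

instance modelIdeal_isTwoSided (X : Finset (Submodule ℂ V)) :
    (modelIdeal X).IsTwoSided := by
  unfold modelIdeal
  infer_instance

/-- The algebra `M(X)`: the quotient of the tensor product by the ideal of the relators. The
polynomial generators have even degree, so the graded tensor product is the ordinary one. -/
abbrev Model (X : Finset (Submodule ℂ V)) : Type _ := (Poly X ⊗[ℚ] Ext X) ⧸ modelIdeal X

/-- The quotient map onto `M(X)`. -/
abbrev toModel (X : Finset (Submodule ℂ V)) : (Poly X ⊗[ℚ] Ext X) →ₐ[ℚ] Model X :=
  Ideal.Quotient.mkₐ ℚ (modelIdeal X)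

/-- The elements of degree `r` of the tensor product, where the polynomial generators have degree
`2` and the exterior generators have degree `1`. -/
def tensorDegree (X : Finset (Submodule ℂ V)) (r : ℕ) : Submodule ℚ (Poly X ⊗[ℚ] Ext X) :=
  ⨆ (i : ℕ) (j : ℕ) (_ : 2 * i + j = r),
    Submodule.map₂ (TensorProduct.mk ℚ (Poly X) (Ext X))
      (MvPolynomial.homogeneousSubmodule X ℚ i) (⋀[ℚ]^j (X →₀ ℚ))

/-- The homogeneous component `M(X)_r`. -/
def modelDegree (X : Finset (Submodule ℂ V)) (r : ℕ) : Submodule ℚ (Model X) :=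
  (tensorDegree X r).map (toModel X).toLinearMap

variable {X : Finset (Submodule ℂ V)}

/-- The image of `c_A` in `M(X)`. -/
def c (A : X) : Model X := toModel X (MvPolynomial.X A ⊗ₜ[ℚ] 1)

/-- The image of `e_A` in `M(X)`. -/
def e (A : X) : Model X := toModel X (1 ⊗ₜ[ℚ] extGen A)

open scoped Classical in
/-- `σ_A = ∑_{B ⊇ A} c_B`. -/
def sigma (A : X) : Model X := ∑ B with A ≤ B, c B

open scoped Classical in
/-- `τ_A = ∑_{B ⊇ A} e_B`. -/
def tau (A : X) : Model X := ∑ B with A ≤ B, e B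

theorem commute_c (A B : X) : Commute (c A) (c B) := by
  unfold c
  refine Commute.map ?_ (toModel X)
  simp [Commute, SemiconjBy, mul_comm]

theorem commute_sigma (A B : X) : Commute (sigma A) (sigma B) :=
  Commute.sum_left _ _ _ fun _ _ => Commute.sum_right _ _ _ fun _ _ => commute_c _ _

/-- The monomial `μ(S, T, m) = ∏_{B ∈ T} τ_B ∏_{A ∈ S} σ_A ^ m(A)`, the first product being taken in
the order of the list `T`. -/
def mu (S : Finset X) (T : List X) (m : S → ℕ) : Model X :=
  (T.map tau).prod *
    Finset.univ.noncommProd (fun A : S => sigma (A : X) ^ m A)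
      fun _ _ _ _ _ => (commute_sigma _ _).pow_pow _ _

open scoped Classical in
/-- For a flag `F` this is the predecessor of `A` in `F`, or `0` if `F` has no element strictly
contained in `A`: the sum of a nonempty finite flag is its largest element. -/
def predecessor (F : Finset X) (A : X) : Submodule ℂ V :=
  (F.filter (· < A)).sup fun B => (B : Submodule ℂ V)

open scoped Classical in
/-- The triples `(S, T, m)` that index the basic monomials of degree `r`. The set `T`, ordered by
inclusion, is given as a strictly increasing list; the exponents are positive, so that the elements
of `S` are those whose `σ` occurs in the monomial. -/
structure BasicIndex (X : Finset (Submodule ℂ V)) (r : ℕ) where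
  S : Finset X
  T : List X
  m : S → ℕ
  sorted : T.Pairwise (· < ·)
  flag : IsChain (· ≤ ·) ((S ∪ T.toFinset : Finset X) : Set X)
  m_pos : ∀ A, 0 < m A
  m_lt : ∀ A : S, m A < Module.finrank ℂ ((A : X) : Submodule ℂ V) -
    Module.finrank ℂ (predecessor (S ∪ T.toFinset) (A : X))
  degree : T.length + 2 * ∑ A, m A = r

end SubspaceModel

end

open scoped TensorProduct

noncomputable section

namespace SubspaceModel

variable {V : Type*} [AddCommGroup V] [Module ℂ V]

/-! ### The dragon marriage condition and its exchange properties -/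

section Dragon

open Module

/-! Spanning is a straightening argument in which the weight of a monomial, the total dimension of
its factors, increases. If `J` is the sum of incomparable `A` and `C`, the relators of exponent 0
give `(x_A - x_J) * (y_C - y_J) = 0`, where `x` and `y` each stand for `σ` or `τ`. So `x_A * y_C` is
a combination of three products of larger weight. On a flag, if the exponent of `σ_A` is at least
`dim A - dim A'`, a factor at the predecessor `A'` can be moved up to `A`, or the monomial vanishes
if `A' = 0`. In fixed degree the weight is bounded, so the process ends at basic monomials
(`mon_mem_of_weight_lt`, `sum_mul_sigma_pow`).

Independence needs enough functionals on the model. For a flag `F`, let variables `x_A` stand for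
the `σ_A`, and send a monomial to 1 if its factors, sorted by the step of `F` in which they lie,
satisfy the dragon marriage condition in every step with the largest possible number of factors;
send it to 0 otherwise. The largest ideal in the kernel, `goodIdeal F`, contains the relations
between the `σ_A`, because the dragon condition obeys an exchange rule that follows from
submodularity of dimension (`dragon_exchange`, `Dragon.replace_cons`). Inverting `σ_A = ∑ c_B` turns
these into relations for the `c_A`. After the `e_A` with `A ∉ F` are killed, every relator vanishes
(`evalTensor_relator`).

For a triple `(S, T, m)` with flag `F = S ∪ T`, multiply by the monomial that completes the `σ`-part
to a good one, apply the functional of `F`, and take the coefficient of `∏ e_B`, `B ∈ T`. The result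
is 1 on `μ(S, T, m)`. If it is nonzero on another basic monomial, the factors of that monomial lie
inside corresponding members of `F`, so its weight is strictly smaller. The resulting matrix is
triangular. -/

/-- The dragon marriage condition, relative to a subspace `p`: every nonempty subfamily `I` of `w`
spans modulo `p` a space of dimension greater than the size of `I`. -/
def Dragon (p : Submodule ℂ V) (w : Multiset (Submodule ℂ V)) : Prop :=
  ∀ I ≤ w, I ≠ 0 → finrank ℂ p + I.card + 1 ≤ finrank ℂ (p ⊔ I.sup : Submodule ℂ V)

theorem dragon_cons {p A : Submodule ℂ V} {w : Multiset (Submodule ℂ V)} :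
    Dragon p (A ::ₘ w) ↔ Dragon p w ∧ ∀ I ≤ w,
      finrank ℂ p + I.card + 2 ≤ finrank ℂ (p ⊔ (A ⊔ I.sup) : Submodule ℂ V) := by
  classical
  constructor
  · intro h
    refine ⟨fun I hI => h I (hI.trans (Multiset.le_cons_self _ _)), fun I hI => ?_⟩
    have := h (A ::ₘ I) (Multiset.cons_le_cons _ hI) (Multiset.cons_ne_zero)
    rwa [Multiset.sup_cons, Multiset.card_cons, ← add_assoc] at this
  · rintro ⟨h₁, h₂⟩ I hI hI0
    by_cases hA : A ∈ I
    · obtain ⟨I', rfl⟩ := Multiset.exists_cons_of_mem hA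
      rw [Multiset.sup_cons, Multiset.card_cons, ← add_assoc]
      exact h₂ I' ((Multiset.cons_le_cons_iff _).1 hI)
    · exact h₁ I ((Multiset.le_cons_of_notMem hA).1 hI) hI0

variable [FiniteDimensional ℂ V]

/-- Submodularity for `q ⊔ A` and `B`, whose intersection contains `A`. It is what keeps the
exponents `dim B - dim A` sufficient after both spaces are enlarged by `q`. -/
theorem finrank_sup_add_le {q A B : Submodule ℂ V} (h : A ≤ B) :
    finrank ℂ (q ⊔ B : Submodule ℂ V) + finrank ℂ A ≤
      finrank ℂ (q ⊔ A : Submodule ℂ V) + finrank ℂ B := by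
  have h₁ := Submodule.finrank_sup_add_finrank_inf_eq (q ⊔ A) B
  have h₂ : finrank ℂ A ≤ finrank ℂ ((q ⊔ A) ⊓ B : Submodule ℂ V) :=
    Submodule.finrank_mono (le_inf le_sup_right h)
  have h₃ : q ⊔ A ⊔ B = q ⊔ B := by rw [sup_assoc, sup_eq_right.2 h]
  rw [h₃] at h₁
  omega

theorem Dragon.cons_mono {p A B : Submodule ℂ V} {w : Multiset (Submodule ℂ V)}
    (hAB : p ⊔ A ≤ p ⊔ B) (h : Dragon p (A ::ₘ w)) : Dragon p (B ::ₘ w) := by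
  rw [dragon_cons] at h ⊢
  refine ⟨h.1, fun I hI => (h.2 I hI).trans (Submodule.finrank_mono ?_)⟩
  rw [← sup_assoc, ← sup_assoc]
  exact sup_le_sup_right hAB _

theorem dragon_cons_congr {p A B : Submodule ℂ V} {w : Multiset (Submodule ℂ V)}
    (hAB : p ⊔ A = p ⊔ B) : Dragon p (A ::ₘ w) ↔ Dragon p (B ::ₘ w) :=
  ⟨.cons_mono hAB.le, .cons_mono hAB.ge⟩

theorem Dragon.finrank_of_replicate {p B : Submodule ℂ V} {w : Multiset (Submodule ℂ V)} {k : ℕ}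
    (hk : k ≠ 0) (h : Dragon p (Multiset.replicate k B + w)) :
    finrank ℂ p + k + 1 ≤ finrank ℂ (p ⊔ B : Submodule ℂ V) := by
  have := h (Multiset.replicate k B) (Multiset.le_add_right _ _) (by
    rw [← Multiset.card_pos]; simpa using Nat.pos_of_ne_zero hk)
  rw [Multiset.card_replicate] at this
  refine this.trans (Submodule.finrank_mono (sup_le_sup_left (Multiset.sup_le.2 ?_) _))
  intro b hb
  rw [Multiset.eq_of_mem_replicate hb]

theorem dragon_replicate {p B : Submodule ℂ V} {k : ℕ}
    (hk : k + finrank ℂ p < finrank ℂ B) : Dragon p (Multiset.replicate k B) := by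
  intro I hI hI0
  obtain ⟨j, hj, rfl⟩ := Multiset.le_replicate_iff.1 hI
  have hj0 : j ≠ 0 := by rintro rfl; simp at hI0
  have : B ≤ p ⊔ (Multiset.replicate j B).sup :=
    (Multiset.le_sup (Multiset.mem_replicate.2 ⟨hj0, rfl⟩)).trans le_sup_right
  have := Submodule.finrank_mono this
  rw [Multiset.card_replicate]
  omega

/-- A subfamily that contains `B` spans the same with `A` as with `B`. For one that does not, adjoin
all `k` copies of `B`: the condition then has a surplus of `k`, which covers the loss of at most
`dim B - dim A` dimensions. -/
theorem Dragon.replace_cons {p A B : Submodule ℂ V} {w : Multiset (Submodule ℂ V)} {k : ℕ}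
    (hAB : A ≤ B) (hk : finrank ℂ B ≤ finrank ℂ A + k)
    (h : Dragon p (B ::ₘ (Multiset.replicate k B + w))) :
    Dragon p (A ::ₘ (Multiset.replicate k B + w)) := by
  classical
  rw [dragon_cons] at h ⊢
  refine ⟨h.1, fun I hI => ?_⟩
  by_cases hB : B ∈ I
  · have h₁ : A ⊔ I.sup = B ⊔ I.sup := by
      rw [sup_eq_right.2 (Multiset.le_sup hB), sup_eq_right.2 (hAB.trans (Multiset.le_sup hB))]
    rw [h₁]
    exact h.2 I hI
  · have hIw : I ≤ w := by
      rw [Multiset.le_iff_count] at hI ⊢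
      intro C
      by_cases hC : C = B
      · subst hC
        simp [Multiset.count_eq_zero_of_notMem hB]
      · simpa [Multiset.count_replicate, Ne.symm hC] using hI C
    have h₁ := h.2 (Multiset.replicate k B + I) (by gcongr)
    have h₂ : p ⊔ (B ⊔ (Multiset.replicate k B + I).sup) ≤ (p ⊔ I.sup) ⊔ B := by
      rw [Multiset.sup_add]
      refine sup_le (le_sup_left.trans le_sup_left) (sup_le le_sup_right (sup_le ?_ ?_))
      · refine Multiset.sup_le.2 fun b hb => ?_
        rw [Multiset.eq_of_mem_replicate hb]
        exact le_sup_right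
      · exact le_sup_right.trans le_sup_left
    have h₃ := Submodule.finrank_mono h₂
    have h₄ := finrank_sup_add_le (q := p ⊔ I.sup) hAB
    have h₅ : p ⊔ (A ⊔ I.sup) = p ⊔ I.sup ⊔ A := by rw [sup_assoc, sup_comm A]
    rw [h₅]
    simp only [Multiset.card_add, Multiset.card_replicate] at h₁
    omega

/-- If `I` violates the condition with `A` and `K` with `C`, submodularity bounds the dimensions
spanned by `I ∪ K` with `A ⊔ C` and by `I ∩ K`. The two copies of `A ⊔ C` in the hypothesis make
that bound fail by one. -/
theorem dragon_cons_or_cons {p A C : Submodule ℂ V} {w : Multiset (Submodule ℂ V)}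
    (h : Dragon p ((A ⊔ C) ::ₘ (A ⊔ C) ::ₘ w)) : Dragon p (A ::ₘ w) ∨ Dragon p (C ::ₘ w) := by
  classical
  rw [dragon_cons, dragon_cons] at h
  obtain ⟨⟨hw, -⟩, hJ⟩ := h
  by_contra hcon
  rw [dragon_cons, dragon_cons] at hcon
  push Not at hcon
  obtain ⟨I, hI, hI'⟩ := hcon.1 hw
  obtain ⟨K, hK, hK'⟩ := hcon.2 hw
  have hU := hJ ((A ⊔ C) ::ₘ (I ∪ K)) (Multiset.cons_le_cons _ (Multiset.union_le hI hK))
  have hcard : (I ∪ K).card + (I ∩ K).card = I.card + K.card := by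
    rw [← Multiset.card_add, Multiset.union_add_inter, Multiset.card_add]
  have hmod := Submodule.finrank_sup_add_finrank_inf_eq (p ⊔ (A ⊔ I.sup)) (p ⊔ (C ⊔ K.sup))
  have hsup : p ⊔ (A ⊔ C ⊔ ((A ⊔ C) ::ₘ (I ∪ K)).sup) ≤ p ⊔ (A ⊔ I.sup) ⊔ (p ⊔ (C ⊔ K.sup)) := by
    rw [Multiset.sup_cons, Multiset.sup_union]
    refine sup_le (le_sup_left.trans le_sup_left) ?_
    have h₁ : A ≤ p ⊔ (A ⊔ I.sup) ⊔ (p ⊔ (C ⊔ K.sup)) :=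
      le_sup_left.trans (le_sup_right.trans le_sup_left)
    have h₂ : C ≤ p ⊔ (A ⊔ I.sup) ⊔ (p ⊔ (C ⊔ K.sup)) :=
      le_sup_left.trans (le_sup_right.trans le_sup_right)
    have h₃ : I.sup ≤ p ⊔ (A ⊔ I.sup) ⊔ (p ⊔ (C ⊔ K.sup)) :=
      le_sup_right.trans (le_sup_right.trans le_sup_left)
    have h₄ : K.sup ≤ p ⊔ (A ⊔ I.sup) ⊔ (p ⊔ (C ⊔ K.sup)) :=
      le_sup_right.trans (le_sup_right.trans le_sup_right)
    exact sup_le (sup_le h₁ h₂) (sup_le (sup_le h₁ h₂) (sup_le h₃ h₄))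
  have hinf : p ⊔ (I ∩ K).sup ≤ (p ⊔ (A ⊔ I.sup)) ⊓ (p ⊔ (C ⊔ K.sup)) := by
    refine le_inf (sup_le_sup_left (le_sup_of_le_right ?_) _)
      (sup_le_sup_left (le_sup_of_le_right ?_) _)
    · exact Multiset.sup_mono (Multiset.subset_of_le Multiset.inter_le_left)
    · exact Multiset.sup_mono (Multiset.subset_of_le Multiset.inter_le_right)
  have hsup' := Submodule.finrank_mono hsup
  have hinf' := Submodule.finrank_mono hinf
  have hN : finrank ℂ p + (I ∩ K).card ≤ finrank ℂ (p ⊔ (I ∩ K).sup : Submodule ℂ V) := by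
    by_cases h0 : I ∩ K = 0
    · rw [h0, Multiset.card_zero, add_zero]
      exact Submodule.finrank_mono le_sup_left
    · have := hw (I ∩ K) (Multiset.inter_le_left.trans hI) h0
      omega
  rw [Multiset.card_cons] at hU
  omega

open scoped Classical in
-- This is the relation `(x_A - x_J) * (x_C - x_J) = 0`, `J = A ⊔ C`, evaluated by the functional.
-- If the condition holds with `J` twice, the indicators factor and the sum is `(1 - a) * (1 - c)`,
-- where `a` or `c` is 1 by `dragon_cons_or_cons`. Otherwise all four terms vanish by monotonicity.
theorem dragon_exchange {p A C : Submodule ℂ V} {w : Multiset (Submodule ℂ V)} :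
    ((if Dragon p (A ::ₘ C ::ₘ w) then 1 else 0 : ℚ) -
      (if Dragon p (A ::ₘ (A ⊔ C) ::ₘ w) then 1 else 0)
      - (if Dragon p ((A ⊔ C) ::ₘ C ::ₘ w) then 1 else 0)) +
      (if Dragon p ((A ⊔ C) ::ₘ (A ⊔ C) ::ₘ w) then 1 else 0) = 0 := by
  have hAJ : p ⊔ A ≤ p ⊔ (A ⊔ C) := sup_le_sup_left le_sup_left _
  have hCJ : p ⊔ C ≤ p ⊔ (A ⊔ C) := sup_le_sup_left le_sup_right _
  by_cases hJJ : Dragon p ((A ⊔ C) ::ₘ (A ⊔ C) ::ₘ w)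
  · have key : ∀ B D : Submodule ℂ V, A ⊔ C ≤ B ⊔ D → (Dragon p (B ::ₘ D ::ₘ w) ↔
        Dragon p (B ::ₘ w) ∧ Dragon p (D ::ₘ w)) := by
      intro B D hBD
      refine ⟨fun h => ⟨fun I hI => h I (hI.trans ?_), (dragon_cons.1 h).1⟩, fun h => ?_⟩
      · exact Multiset.cons_le_cons _ (Multiset.le_cons_self _ _)
      · rw [dragon_cons]
        refine ⟨h.2, fun I hI => ?_⟩
        by_cases hD : D ∈ I
        · obtain ⟨I', rfl⟩ := Multiset.exists_cons_of_mem hD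
          have h₁ := (dragon_cons.1 hJJ).2 ((A ⊔ C) ::ₘ I')
            (Multiset.cons_le_cons _ ((Multiset.cons_le_cons_iff _).1 hI))
          rw [Multiset.card_cons] at h₁ ⊢
          refine h₁.trans (Submodule.finrank_mono (sup_le_sup_left ?_ _))
          rw [Multiset.sup_cons, Multiset.sup_cons, ← sup_assoc (A ⊔ C), ← sup_assoc B, sup_idem]
          exact sup_le_sup_right hBD _
        · exact (dragon_cons.1 h.1).2 I ((Multiset.le_cons_of_notMem hD).1 hI)
    have hJ : Dragon p ((A ⊔ C) ::ₘ w) := (dragon_cons.1 hJJ).1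
    rw [if_pos hJJ]
    simp only [key A C le_rfl, key A (A ⊔ C) le_sup_right, key (A ⊔ C) C le_sup_left, hJ]
    rcases dragon_cons_or_cons hJJ with h | h <;>
      simp only [h, and_true, true_and] <;> simp
  · have h₁ : ¬ Dragon p (A ::ₘ (A ⊔ C) ::ₘ w) := fun h => hJJ (h.cons_mono hAJ)
    have h₂ : ¬ Dragon p ((A ⊔ C) ::ₘ C ::ₘ w) := fun h => hJJ (by
      rw [Multiset.cons_swap] at h
      exact h.cons_mono hCJ)
    have h₃ : ¬ Dragon p (A ::ₘ C ::ₘ w) := fun h => h₂ (h.cons_mono hAJ)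
    simp [hJJ, h₁, h₂, h₃]

end Dragon

/-! ### Levels of a flag and the functional on polynomials -/

section Level

open Module
open scoped Classical

variable {X : Finset (Submodule ℂ V)} {F : Finset X}

theorem le_predecessor {A B : X} (hB : B ∈ F) (h : B < A) :
    (B : Submodule ℂ V) ≤ predecessor F A :=
  Finset.le_sup (f := fun B : X => (B : Submodule ℂ V)) (Finset.mem_filter.2 ⟨hB, h⟩)

theorem predecessor_le (A : X) : predecessor F A ≤ A :=
  Finset.sup_le fun _ hB => (Finset.mem_filter.1 hB).2.le

theorem exists_isGreatest_of_isChain {G : Finset X} (hG : IsChain (· ≤ ·) (G : Set X))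
    (h : G.Nonempty) : ∃ B ∈ G, (∀ C ∈ G, C ≤ B) ∧ (G.sup fun B => (B : Submodule ℂ V)) = B := by
  obtain ⟨B, hB⟩ := G.exists_maximal h
  have hmax : ∀ C ∈ G, C ≤ B := fun C hC =>
    (hG.total hC hB.1).elim id fun h => hB.2 hC h
  exact ⟨B, hB.1, hmax, le_antisymm (Finset.sup_le fun C hC => hmax C hC)
    (Finset.le_sup (f := fun B : X => (B : Submodule ℂ V)) hB.1)⟩

theorem predecessor_cases (hF : IsChain (· ≤ ·) (F : Set X)) (A : X) :
    predecessor F A = ⊥ ∨ ∃ B ∈ F, B < A ∧ predecessor F A = B := by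
  rcases (F.filter (· < A)).eq_empty_or_nonempty with h | h
  · left
    simp [predecessor, h]
  · right
    obtain ⟨B, hB, -, h⟩ := exists_isGreatest_of_isChain
      (hF.mono (Finset.coe_subset.2 (Finset.filter_subset _ _))) h
    exact ⟨B, (Finset.mem_filter.1 hB).1, (Finset.mem_filter.1 hB).2, h⟩

/-- `C` is contained in `A` but not in the predecessor of `A` in the flag `F`. -/
def Level (F : Finset X) (A C : X) : Prop :=
  C ≤ A ∧ ¬ (C : Submodule ℂ V) ≤ predecessor F A

theorem exists_level (hX : ∀ A ∈ X, A ≠ ⊥) (hF : IsChain (· ≤ ·) (F : Set X)) {C : X}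
    (h : ∃ A ∈ F, C ≤ A) : ∃ A ∈ F, Level F A C := by
  have hne : (F.filter (C ≤ ·)).Nonempty := by
    obtain ⟨A, hA, hCA⟩ := h
    exact ⟨A, Finset.mem_filter.2 ⟨hA, hCA⟩⟩
  obtain ⟨A, hA⟩ := (F.filter (C ≤ ·)).exists_minimal hne
  obtain ⟨hAF, hCA⟩ := Finset.mem_filter.1 hA.1
  refine ⟨A, hAF, hCA, fun hC => ?_⟩
  rcases predecessor_cases hF A with h | ⟨B, hB, hBA, h⟩
  · rw [h, le_bot_iff] at hC
    exact hX _ C.2 hC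
  · rw [h] at hC
    exact hBA.not_ge (hA.2 (Finset.mem_filter.2 ⟨hB, hC⟩) hBA.le)

theorem Level.unique (hF : IsChain (· ≤ ·) (F : Set X)) {A B C : X} (hA : A ∈ F) (hB : B ∈ F)
    (hAC : Level F A C) (hBC : Level F B C) : A = B := by
  by_contra hne
  rcases hF.total hA hB with h | h
  · exact hBC.2 (le_trans (b := (A : Submodule ℂ V)) hAC.1
      (le_predecessor hA (lt_of_le_of_ne h hne)))
  · exact hAC.2 (le_trans (b := (B : Submodule ℂ V)) hBC.1
      (le_predecessor hB (lt_of_le_of_ne h (Ne.symm hne))))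

theorem Level.mono {A B C : X} (h : Level F A B) (hBC : B ≤ C) (hCA : C ≤ A) : Level F A C :=
  ⟨hCA, fun hC => h.2 (le_trans (b := (C : Submodule ℂ V)) hBC hC)⟩

theorem level_self {A : X} (hX : ∀ A ∈ X, A ≠ ⊥) (hF : IsChain (· ≤ ·) (F : Set X)) :
    Level F A A := by
  refine ⟨le_rfl, fun h => ?_⟩
  rcases predecessor_cases hF A with h' | ⟨B, -, hBA, h'⟩
  · rw [h', le_bot_iff] at h
    exact hX _ A.2 h
  · rw [h'] at h
    exact hBA.not_ge h

/-- The members of `w` on the level of `A`. -/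
def part (F : Finset X) (A : X) (w : Multiset X) : Multiset (Submodule ℂ V) :=
  (w.filter (Level F A)).map (↑)

theorem part_add (A : X) (u w : Multiset X) : part F A (u + w) = part F A u + part F A w := by
  simp [part]

theorem part_of_level {A : X} {u : Multiset X} (hu : ∀ C ∈ u, Level F A C) :
    part F A u = u.map (↑) := by
  rw [part, Multiset.filter_eq_self.2 hu]

theorem part_of_level_ne (hF : IsChain (· ≤ ·) (F : Set X)) {A B : X} (hA : A ∈ F) (hB : B ∈ F)
    (hBA : B ≠ A) {u : Multiset X} (hu : ∀ C ∈ u, Level F A C) : part F B u = 0 := by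
  rw [part, Multiset.filter_eq_nil.2 fun C hC h => hBA (h.unique hF hB hA (hu C hC)),
    Multiset.map_zero]

/-- The monomials on which the functional of the flag `F` takes the value `1`: the members on the
level of each `A ∈ F` satisfy the dragon marriage condition relative to the predecessor of `A`, and
their number is the greatest possible. -/
def Good (F : Finset X) (w : Multiset X) : Prop :=
  (∀ C ∈ w, ∃ A ∈ F, C ≤ A) ∧ ∀ A ∈ F,
    (part F A w).card + finrank ℂ (predecessor F A) + 1 = finrank ℂ (A : Submodule ℂ V) ∧
      Dragon (predecessor F A) (part F A w)

/-- The conditions in `Good F (u + w)` that depend only on the size `k` of `u`, if `u` is on the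
level of `A`. -/
def GoodRest (F : Finset X) (A : X) (k : ℕ) (w : Multiset X) : Prop :=
  (∀ C ∈ w, ∃ A ∈ F, C ≤ A) ∧
    k + (part F A w).card + finrank ℂ (predecessor F A) + 1 = finrank ℂ (A : Submodule ℂ V) ∧
    ∀ B ∈ F, B ≠ A →
      (part F B w).card + finrank ℂ (predecessor F B) + 1 = finrank ℂ (B : Submodule ℂ V) ∧
        Dragon (predecessor F B) (part F B w)

/-- Members on the level of `A` affect no other level. Comparing monomials that differ only there
thus reduces to comparing `Dragon` on one level. -/
theorem good_add_iff (hF : IsChain (· ≤ ·) (F : Set X)) {A : X} (hA : A ∈ F) {u : Multiset X}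
    (hu : ∀ C ∈ u, Level F A C) (w : Multiset X) :
    Good F (u + w) ↔ GoodRest F A u.card w ∧
      Dragon (predecessor F A) (u.map (↑) + part F A w) := by
  have hAu := part_of_level hu
  have hBu : ∀ B ∈ F, B ≠ A → part F B u = 0 := fun B hB hBA => part_of_level_ne hF hA hB hBA hu
  constructor
  · rintro ⟨h₁, h₂⟩
    refine ⟨⟨fun C hC => h₁ C (Multiset.mem_add.2 (Or.inr hC)), ?_, fun B hB hBA => ?_⟩, ?_⟩
    · have := (h₂ A hA).1
      rwa [part_add, hAu, Multiset.card_add, Multiset.card_map] at this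
    · have := h₂ B hB
      rwa [part_add, hBu B hB hBA, zero_add] at this
    · have := (h₂ A hA).2
      rwa [part_add, hAu] at this
  · rintro ⟨⟨h₁, h₂, h₃⟩, h₄⟩
    refine ⟨fun C hC => ?_, fun B hB => ?_⟩
    · rcases Multiset.mem_add.1 hC with h | h
      · exact ⟨A, hA, (hu C h).1⟩
      · exact h₁ C h
    · by_cases hBA : B = A
      · subst hBA
        rw [part_add, hAu, Multiset.card_add, Multiset.card_map]
        exact ⟨h₂, h₄⟩
      · rw [part_add, hBu B hB hBA, zero_add]
        exact h₃ B hB hBA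

theorem prod_map_X (w : Multiset X) :
    (w.map (MvPolynomial.X : X → Poly X)).prod =
      MvPolynomial.monomial (Multiset.toFinsupp w) 1 := by
  induction w using Multiset.induction_on with
  | empty => simp
  | cons A w ih =>
    rw [Multiset.map_cons, Multiset.prod_cons, ih, ← Multiset.singleton_add, map_add,
      Multiset.toFinsupp_singleton, MvPolynomial.X, MvPolynomial.monomial_mul, one_mul]

/-- The functional on polynomials that sends a monomial to `1` if it is good and to `0`
otherwise. -/
def goodFun (F : Finset X) : Poly X →ₗ[ℚ] ℚ :=
  (MvPolynomial.basisMonomials X ℚ).constr ℚ fun α => if Good F (Finsupp.toMultiset α) then 1 else 0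

theorem goodFun_prod (w : Multiset X) :
    goodFun F (w.map MvPolynomial.X).prod = if Good F w then 1 else 0 := by
  have h : MvPolynomial.monomial (Multiset.toFinsupp w) (1 : ℚ) =
      MvPolynomial.basisMonomials X ℚ (Multiset.toFinsupp w) := by simp
  rw [prod_map_X, h, goodFun, Basis.constr_basis]
  simp

/-- The largest ideal in the kernel of `goodFun F`. -/
def goodIdeal (F : Finset X) : Ideal (Poly X) where
  carrier := {q | ∀ r, goodFun F (q * r) = 0}
  add_mem' h₁ h₂ r := by rw [add_mul, map_add, h₁, h₂, add_zero]
  zero_mem' r := by simp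
  smul_mem' a q h r := by
    have h' : a • q * r = q * (a * r) := by rw [smul_eq_mul]; ring
    rw [h']
    exact h _

theorem mem_goodIdeal_iff {q : Poly X} : q ∈ goodIdeal F ↔
    ∀ w : Multiset X, goodFun F (q * (w.map MvPolynomial.X).prod) = 0 := by
  refine ⟨fun h w => h _, fun h r => ?_⟩
  have : goodFun F ∘ₗ LinearMap.mulLeft ℚ q = 0 := by
    refine (MvPolynomial.basisMonomials X ℚ).ext fun α => ?_
    have := h (Finsupp.toMultiset α)
    rw [prod_map_X] at this
    simpa using this
  exact LinearMap.congr_fun this r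

end Level

/-! ### Relations between the variables `x_A` modulo the kernel ideal -/

section GoodIdeal

open Module
open scoped Classical

variable {X : Finset (Submodule ℂ V)} {F : Finset X}

theorem X_mem_goodIdeal_of_not_le {C : X} (hC : ¬ ∃ A ∈ F, C ≤ A) :
    MvPolynomial.X C ∈ goodIdeal F := by
  rw [mem_goodIdeal_iff]
  intro w
  rw [← Multiset.prod_cons, ← Multiset.map_cons, goodFun_prod, if_neg]
  exact fun h => hC (h.1 C (Multiset.mem_cons_self _ _))

variable [FiniteDimensional ℂ V]

theorem X_sub_X_mem_goodIdeal_of_level (hF : IsChain (· ≤ ·) (F : Set X)) {A C J : X} (hA : A ∈ F)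
    (hC : Level F A C) (hJ : Level F A J)
    (h : predecessor F A ⊔ (C : Submodule ℂ V) = predecessor F A ⊔ J) :
    MvPolynomial.X C - MvPolynomial.X J ∈ goodIdeal F := by
  rw [mem_goodIdeal_iff]
  intro w
  have key : Good F (C ::ₘ w) ↔ Good F (J ::ₘ w) := by
    rw [← Multiset.singleton_add, ← Multiset.singleton_add, good_add_iff hF hA (by simpa using hC),
      good_add_iff hF hA (by simpa using hJ)]
    simp only [Multiset.map_singleton, Multiset.singleton_add, Multiset.card_singleton,
      dragon_cons_congr h]
  rw [sub_mul, map_sub, ← Multiset.prod_cons, ← Multiset.map_cons, ← Multiset.prod_cons,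
    ← Multiset.map_cons, goodFun_prod, goodFun_prod, if_congr key rfl rfl, sub_self]

theorem X_pow_mem_goodIdeal_of_level (hF : IsChain (· ≤ ·) (F : Set X)) {A B : X} (hA : A ∈ F)
    (hB : Level F A B) {k : ℕ}
    (hk : finrank ℂ (predecessor F A ⊔ B : Submodule ℂ V) ≤ finrank ℂ (predecessor F A) + k) :
    MvPolynomial.X B ^ k ∈ goodIdeal F := by
  have hk0 : k ≠ 0 := by
    rintro rfl
    refine hB.2 (left_eq_sup.1 (Submodule.eq_of_le_of_finrank_le le_sup_left hk))
  rw [mem_goodIdeal_iff]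
  intro w
  have hprod : MvPolynomial.X B ^ k * (w.map (MvPolynomial.X : X → Poly X)).prod =
      ((Multiset.replicate k B + w).map MvPolynomial.X).prod := by
    simp
  rw [hprod, goodFun_prod, if_neg]
  rw [good_add_iff hF hA (fun C hC => by rwa [Multiset.eq_of_mem_replicate hC])]
  rintro ⟨-, h⟩
  rw [Multiset.map_replicate] at h
  have := h.finrank_of_replicate hk0
  omega

variable (hX : ∀ A ∈ X, A ≠ ⊥) (hF : IsChain (· ≤ ·) (F : Set X))
include hX hF

theorem X_sub_mul_X_sub_mem_goodIdeal {A C J : X}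
    (hJ : (J : Submodule ℂ V) = (A : Submodule ℂ V) ⊔ C) :
    (MvPolynomial.X A - MvPolynomial.X J) * (MvPolynomial.X C - MvPolynomial.X J) ∈
      goodIdeal F := by
  have hAJ : A ≤ J := by rw [← Subtype.coe_le_coe, hJ]; exact le_sup_left
  have hCJ : C ≤ J := by rw [← Subtype.coe_le_coe, hJ]; exact le_sup_right
  by_cases hcov : ∃ B ∈ F, J ≤ B
  · obtain ⟨B, hB, hlev⟩ := exists_level hX hF hcov
    set p := predecessor F B with hp
    -- If `A` or `C` lies in the predecessor, the other one and `J` agree modulo it, and a single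
    -- factor is already in the ideal.
    by_cases hAB : (A : Submodule ℂ V) ≤ p
    · have hCB : Level F B C := ⟨hCJ.trans hlev.1, fun h => hlev.2 (hJ ▸ sup_le hAB h)⟩
      refine Ideal.mul_mem_left _ _ (X_sub_X_mem_goodIdeal_of_level hF hB hCB hlev ?_)
      rw [hJ, ← sup_assoc, ← hp, sup_eq_left.2 hAB]
    by_cases hCB : (C : Submodule ℂ V) ≤ p
    · refine Ideal.mul_mem_right _ _ (X_sub_X_mem_goodIdeal_of_level hF hB ⟨hAJ.trans hlev.1, hAB⟩
        hlev ?_)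
      rw [hJ, sup_comm (A : Submodule ℂ V), ← sup_assoc, ← hp, sup_eq_left.2 hCB]
    have hlA : Level F B A := ⟨hAJ.trans hlev.1, hAB⟩
    have hlC : Level F B C := ⟨hCJ.trans hlev.1, hCB⟩
    rw [mem_goodIdeal_iff]
    intro w
    have key : ∀ D E : X, Level F B D → Level F B E →
        goodFun F (MvPolynomial.X D * MvPolynomial.X E * (w.map MvPolynomial.X).prod) =
          if GoodRest F B 2 w then
            (if Dragon p ((D : Submodule ℂ V) ::ₘ (E : Submodule ℂ V) ::ₘ part F B w) then 1 else 0)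
          else 0 := by
      intro D E hD hE
      have hprod : MvPolynomial.X D * MvPolynomial.X E *
          (w.map (MvPolynomial.X : X → Poly X)).prod =
          ((({D, E} : Multiset X) + w).map MvPolynomial.X).prod := by
        simp [mul_assoc]
      have hlev : ∀ C ∈ ({D, E} : Multiset X), Level F B C := by
        simp [hD, hE]
      rw [hprod, goodFun_prod, if_congr (good_add_iff hF hB hlev w) rfl rfl, ← hp]
      simp [ite_and]
    have hexp : (MvPolynomial.X A - MvPolynomial.X J) * (MvPolynomial.X C - MvPolynomial.X J) *
          (w.map (MvPolynomial.X : X → Poly X)).prod =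
        MvPolynomial.X A * MvPolynomial.X C * (w.map MvPolynomial.X).prod -
        MvPolynomial.X A * MvPolynomial.X J * (w.map MvPolynomial.X).prod -
        MvPolynomial.X J * MvPolynomial.X C * (w.map MvPolynomial.X).prod +
        MvPolynomial.X J * MvPolynomial.X J * (w.map MvPolynomial.X).prod := by
      ring
    rw [hexp, map_add, map_sub, map_sub, key A C hlA hlC, key A J hlA hlev, key J C hlev hlC,
      key J J hlev hlev]
    by_cases hrest : GoodRest F B 2 w
    · simp only [if_pos hrest, hJ]
      exact dragon_exchange
    · simp [hrest]
  · have hJ0 : MvPolynomial.X J ∈ goodIdeal F := X_mem_goodIdeal_of_not_le hcov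
    -- If both `A` and `C` were inside members of the flag, the larger of the two members would
    -- contain `J`.
    have hAC : MvPolynomial.X A * MvPolynomial.X C ∈ goodIdeal F := by
      by_cases hA : ∃ B ∈ F, A ≤ B
      · refine Ideal.mul_mem_left _ _ (X_mem_goodIdeal_of_not_le fun hC => hcov ?_)
        obtain ⟨B, hB, hAB⟩ := hA
        obtain ⟨D, hD, hCD⟩ := hC
        rcases hF.total hB hD with h | h
        · refine ⟨D, hD, ?_⟩
          rw [← Subtype.coe_le_coe, hJ]
          exact sup_le (hAB.trans h) hCD
        · refine ⟨B, hB, ?_⟩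
          rw [← Subtype.coe_le_coe, hJ]
          exact sup_le hAB (hCD.trans h)
      · exact Ideal.mul_mem_right _ _ (X_mem_goodIdeal_of_not_le hA)
    have hexp : (MvPolynomial.X A - MvPolynomial.X J) * (MvPolynomial.X C - MvPolynomial.X J) =
        (MvPolynomial.X A * MvPolynomial.X C : Poly X) -
          (MvPolynomial.X A + MvPolynomial.X C - MvPolynomial.X J) * MvPolynomial.X J := by
      ring
    rw [hexp]
    exact Ideal.sub_mem _ hAC (Ideal.mul_mem_left _ _ hJ0)

/-- Any level that contains `B` lies above `A`, so `A` is inside its predecessor and is invisible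
there. This accounts for the relators in which `e_A` occurs. -/
theorem X_sub_X_mem_goodIdeal {A B J : X} (hA : A ∈ F) (hBA : ¬ B ≤ A)
    (hJ : (J : Submodule ℂ V) = (A : Submodule ℂ V) ⊔ B) :
    MvPolynomial.X B - MvPolynomial.X J ∈ goodIdeal F := by
  have hBJ : B ≤ J := by rw [← Subtype.coe_le_coe, hJ]; exact le_sup_right
  by_cases hcov : ∃ D ∈ F, B ≤ D
  · obtain ⟨D, hD, hlev⟩ := exists_level hX hF hcov
    have hAD : A < D := by
      rcases hF.total hA hD with h | h
      · exact lt_of_le_of_ne h fun h' => hBA (h' ▸ hlev.1)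
      · exact absurd (hlev.1.trans h) hBA
    have hJD : J ≤ D := by
      rw [← Subtype.coe_le_coe, hJ]
      exact sup_le hAD.le hlev.1
    refine X_sub_X_mem_goodIdeal_of_level hF hD hlev (hlev.mono hBJ hJD) ?_
    rw [hJ, ← sup_assoc, sup_eq_left.2 (le_predecessor hA hAD)]
  · refine Ideal.sub_mem _ (X_mem_goodIdeal_of_not_le hcov)
      (X_mem_goodIdeal_of_not_le fun ⟨D, hD, hJD⟩ => hcov ⟨D, hD, hBJ.trans hJD⟩)

theorem X_pow_mem_goodIdeal_of_le {q : Submodule ℂ V} {B : X} {k : ℕ} (hk0 : k ≠ 0)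
    (hk : finrank ℂ (B : Submodule ℂ V) ≤ finrank ℂ q + k) (hqB : q ≤ B)
    (hq : ∀ D ∈ F, Level F D B → q ≤ predecessor F D) :
    MvPolynomial.X B ^ k ∈ goodIdeal F := by
  by_cases hcov : ∃ D ∈ F, B ≤ D
  · obtain ⟨D, hD, hlev⟩ := exists_level hX hF hcov
    refine X_pow_mem_goodIdeal_of_level hF hD hlev ?_
    have := finrank_sup_add_le (q := predecessor F D) hqB
    rw [sup_eq_left.2 (hq D hD hlev)] at this
    omega
  · exact Ideal.pow_mem_of_mem _ (X_mem_goodIdeal_of_not_le hcov) _ (Nat.pos_of_ne_zero hk0)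

theorem X_pow_finrank_mem_goodIdeal (B : X) :
    MvPolynomial.X B ^ finrank ℂ (B : Submodule ℂ V) ∈ goodIdeal F := by
  refine X_pow_mem_goodIdeal_of_le hX hF (q := ⊥) ?_ (by simp) bot_le fun _ _ _ => bot_le
  rw [Ne, Submodule.finrank_eq_zero]
  exact hX _ B.2

omit hX hF in
theorem finrank_lt_of_lt {A B : X} (h : A < B) :
    finrank ℂ (A : Submodule ℂ V) < finrank ℂ (B : Submodule ℂ V) :=
  Submodule.finrank_lt_finrank_of_lt h

theorem X_pow_sub_mem_goodIdeal {A B : X} (hA : A ∈ F) (hAB : A < B) :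
    MvPolynomial.X B ^ (finrank ℂ (B : Submodule ℂ V) - finrank ℂ (A : Submodule ℂ V)) ∈
      goodIdeal F := by
  have hlt := finrank_lt_of_lt hAB
  refine X_pow_mem_goodIdeal_of_le hX hF (q := A) (by omega) (by omega) hAB.le
    fun D hD hlev => le_predecessor hA ?_
  rcases hF.total hA hD with h | h
  · exact lt_of_le_of_ne h fun h' => hAB.not_ge (h' ▸ hlev.1)
  · exact absurd (hlev.1.trans h) hAB.not_ge

theorem X_sub_mul_X_pow_mem_goodIdeal {A B : X} (hAB : A < B) :
    (MvPolynomial.X A - MvPolynomial.X B) *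
      MvPolynomial.X B ^ (finrank ℂ (B : Submodule ℂ V) - finrank ℂ (A : Submodule ℂ V)) ∈
      goodIdeal F := by
  have hlt := finrank_lt_of_lt hAB
  set k := finrank ℂ (B : Submodule ℂ V) - finrank ℂ (A : Submodule ℂ V) with hk
  -- If `A` is not on the level of `B`, it lies in the predecessor, and the power of `x_B` vanishes
  -- alone.
  by_cases hcov : ∃ D ∈ F, Level F D B ∧ Level F D A
  · obtain ⟨D, hD, hlB, hlA⟩ := hcov
    rw [mem_goodIdeal_iff]
    intro w
    have key : ∀ C : X, Level F D C →
        (Good F ((C ::ₘ Multiset.replicate k B) + w) ↔ GoodRest F D (k + 1) w ∧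
          Dragon (predecessor F D) ((C : Submodule ℂ V) ::ₘ
            (Multiset.replicate k (B : Submodule ℂ V) + part F D w))) := by
      intro C hC
      rw [good_add_iff hF hD]
      · simp [Multiset.map_replicate]
      · intro E hE
        rcases Multiset.mem_cons.1 hE with rfl | hE
        · exact hC
        · rwa [Multiset.eq_of_mem_replicate hE]
    have hiff : Good F ((A ::ₘ Multiset.replicate k B) + w) ↔
        Good F ((B ::ₘ Multiset.replicate k B) + w) := by
      rw [key A hlA, key B hlB]
      refine and_congr_right fun _ => ⟨.cons_mono (sup_le_sup_left hAB.le _),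
        .replace_cons hAB.le (by omega)⟩
    have hexp : (MvPolynomial.X A - MvPolynomial.X B) * MvPolynomial.X B ^ k *
          (w.map (MvPolynomial.X : X → Poly X)).prod =
        (((A ::ₘ Multiset.replicate k B) + w).map MvPolynomial.X).prod -
        (((B ::ₘ Multiset.replicate k B) + w).map MvPolynomial.X).prod := by
      simp only [Multiset.map_add, Multiset.map_cons, Multiset.map_replicate, Multiset.prod_add,
        Multiset.prod_cons, Multiset.prod_replicate]
      ring
    rw [hexp, map_sub, goodFun_prod, goodFun_prod, if_congr hiff rfl rfl, sub_self]
  · refine Ideal.mul_mem_left _ _ (X_pow_mem_goodIdeal_of_le hX hF (q := A) (by omega) (by omega)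
      hAB.le fun D hD hlev => ?_)
    by_contra hA
    exact hcov ⟨D, hD, hlev, hAB.le.trans hlev.1, hA⟩

end GoodIdeal

/-! ### From relations between the `σ_A` to relations between the `c_A` -/

section Inversion

open Module
open scoped Classical

variable {X : Finset (Submodule ℂ V)}

theorem exists_sum_ge_eq {M : Type*} [AddCommGroup M] (f : X → M) :
    ∃ g : X → M, ∀ A, ∑ B with A ≤ B, g B = f A := by
  let g : X → M := (wellFounded_gt (α := X)).fix fun A ih =>
    f A - ∑ B : {B // A < B}, ih B.1 B.2
  have hg : ∀ A, g A = f A - ∑ B : {B // A < B}, g B := fun A =>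
    (wellFounded_gt (α := X)).fix_eq _ A
  refine ⟨g, fun A => ?_⟩
  have h₁ : (Finset.univ.filter (A ≤ ·)) = insert A (Finset.univ.filter (A < ·)) := by
    ext B
    simp [le_iff_eq_or_lt, eq_comm]
  rw [h₁, Finset.sum_insert (by simp), hg A, Finset.sum_subtype (p := (A < ·)) _ (by simp) g]
  abel

theorem sum_ge_sub_sum_ge {M : Type*} [AddCommGroup M] (g : X → M) {A J : X} (h : A ≤ J) :
    ∑ B with A ≤ B, g B - ∑ B with J ≤ B, g B = ∑ B with A ≤ B ∧ ¬ J ≤ B, g B := by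
  rw [← Finset.sum_filter_add_sum_filter_not (Finset.univ.filter (A ≤ ·)) (J ≤ ·),
    Finset.filter_filter, Finset.filter_filter,
    Finset.filter_congr (p := fun B => A ≤ B ∧ J ≤ B) (q := fun B => J ≤ B)
      fun B _ => ⟨And.right, fun hB => ⟨h.trans hB, hB⟩⟩]
  abel

theorem mem_of_sum_mem {R ι : Type*} [Ring R] {K : Ideal R} {s : Finset ι} {x : ι → R}
    (h : ∑ i ∈ s, x i ∈ K) {a : ι} (ha : a ∈ s) (hx : ∀ i ∈ s, i ≠ a → x i ∈ K) : x a ∈ K := by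
  rw [← Finset.add_sum_erase s x ha] at h
  exact (K.add_mem_iff_left (K.sum_mem fun i hi =>
    hx i (Finset.mem_of_mem_erase hi) (Finset.ne_of_mem_erase hi))).1 h

theorem le_join_iff {A B J E : X} (hJ : (J : Submodule ℂ V) = (A : Submodule ℂ V) ⊔ B) :
    J ≤ E ↔ A ≤ E ∧ B ≤ E := by
  rw [← Subtype.coe_le_coe, hJ, sup_le_iff, Subtype.coe_le_coe, Subtype.coe_le_coe]

variable (hsup : SupClosed (X : Set (Submodule ℂ V)))
include hsup

theorem exists_join (A B : X) : ∃ J : X, (J : Submodule ℂ V) = (A : Submodule ℂ V) ⊔ B :=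
  ⟨⟨_, hsup A.2 B.2⟩, rfl⟩

variable {R : Type*} [CommRing R] {K : Ideal R} {f g : X → R}
  (hfg : ∀ A, ∑ B with A ≤ B, g B = f A)
include hfg

/-- Here `f B - f J` is the sum of `g E` over `E ≥ B` not above `J`. These `E` are again
incomparable to `A`, so downward induction isolates `g B`. The lemma serves with `z = g A`, and with
`z = 1` when `A` is in the flag. -/
theorem mul_mem_of_mul_sub_mem {z : R} {A : X}
    (hz : ∀ B J : X, (J : Submodule ℂ V) = (A : Submodule ℂ V) ⊔ B → ¬ B ≤ A →
      z * (f B - f J) ∈ K) :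
    ∀ B : X, ¬ A ≤ B → ¬ B ≤ A → z * g B ∈ K := by
  intro B
  induction B using (wellFounded_gt (α := X)).induction with
  | _ B ih =>
    intro hAB hBA
    obtain ⟨J, hJ⟩ := exists_join hsup A B
    have hBJ : B ≤ J := ((le_join_iff hJ).1 le_rfl).2
    have h := hz B J hJ hBA
    rw [← hfg, ← hfg, sum_ge_sub_sum_ge g hBJ, Finset.mul_sum] at h
    refine mem_of_sum_mem (x := fun E => z * g E) h (a := B) ?_ fun E hE hEB => ?_
    · rw [Finset.mem_filter, le_join_iff hJ]
      exact ⟨Finset.mem_univ _, le_rfl, fun h => hAB h.1⟩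
    · obtain ⟨-, hBE, hJE⟩ := Finset.mem_filter.1 hE
      rw [le_join_iff hJ] at hJE
      exact ih E (lt_of_le_of_ne hBE (Ne.symm hEB)) (fun h => hJE ⟨h, hBE⟩)
        fun h => hBA (hBE.trans h)

variable (hmul : ∀ A C J : X, (J : Submodule ℂ V) = (A : Submodule ℂ V) ⊔ C →
    (f A - f J) * (f C - f J) ∈ K)
include hmul

theorem mul_sub_mem (A : X) : ∀ B J : X, (J : Submodule ℂ V) = (A : Submodule ℂ V) ⊔ B →
    ¬ B ≤ A → g A * (f B - f J) ∈ K := by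
  induction A using (wellFounded_gt (α := X)).induction with
  | _ A ih =>
    intro B J hJ hBA
    have hAJ : A ≤ J := ((le_join_iff hJ).1 le_rfl).1
    have hBJ : B ≤ J := ((le_join_iff hJ).1 le_rfl).2
    have h := hmul A B J hJ
    rw [← hfg A, ← hfg J, sum_ge_sub_sum_ge g hAJ, hfg, Finset.sum_mul] at h
    refine mem_of_sum_mem (x := fun E => g E * (f B - f J)) h (a := A) ?_ fun E hE hEA => ?_
    · rw [Finset.mem_filter, le_join_iff hJ]
      exact ⟨Finset.mem_univ _, le_rfl, fun h => hBA h.2⟩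
    · obtain ⟨-, hAE, hJE⟩ := Finset.mem_filter.1 hE
      have hBE : ¬ B ≤ E := fun h => hJE ((le_join_iff hJ).2 ⟨hAE, h⟩)
      have hlt := lt_of_le_of_ne hAE (Ne.symm hEA)
      obtain ⟨L, hL⟩ := exists_join hsup E B
      have h₁ := ih E hlt B L hL hBE
      -- `L` is also the join of `E` and `J`, since `A ≤ E`.
      have h₂ := ih E hlt J L (by
        rw [hL, hJ, ← sup_assoc, sup_eq_left.2 (show (A : Submodule ℂ V) ≤ E from hAE)]) hJE
      have h₃ : g E * (f B - f J) = g E * (f B - f L) - g E * (f J - f L) := by ring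
      rw [h₃]
      exact K.sub_mem h₁ h₂

theorem mul_mem_of_incomparable {A B : X} (hAB : ¬ A ≤ B) (hBA : ¬ B ≤ A) : g A * g B ∈ K :=
  mul_mem_of_mul_sub_mem hsup hfg (mul_sub_mem hsup hfg hmul A) B hAB hBA

/-- Expand `f A - f B` and remove the terms with `E > A`: against `g E`, `f B` may be replaced by `f
L` for `L = E ⊔ B`, and `dim L - dim E ≤ dim B - dim A`, so the induction hypothesis for `E < L`
applies. -/
theorem mul_pow_mem [FiniteDimensional ℂ V]
    (hpow : ∀ A B : X, A < B → (f A - f B) *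
      f B ^ (finrank ℂ (B : Submodule ℂ V) - finrank ℂ (A : Submodule ℂ V)) ∈ K) (A : X) :
    ∀ B : X, A < B → g A *
      f B ^ (finrank ℂ (B : Submodule ℂ V) - finrank ℂ (A : Submodule ℂ V)) ∈ K := by
  induction A using (wellFounded_gt (α := X)).induction with
  | _ A ih =>
    intro B hAB
    have h := hpow A B hAB
    rw [← hfg A, ← hfg B, sum_ge_sub_sum_ge g hAB.le, hfg, Finset.sum_mul] at h
    refine mem_of_sum_mem (x := fun E => g E * f B ^ (_ : ℕ)) h (a := A) ?_ fun E hE hEA => ?_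
    · rw [Finset.mem_filter]
      exact ⟨Finset.mem_univ _, le_rfl, hAB.not_ge⟩
    · obtain ⟨-, hAE, hBE⟩ := Finset.mem_filter.1 hE
      have hlt := lt_of_le_of_ne hAE (Ne.symm hEA)
      obtain ⟨L, hL⟩ := exists_join hsup E B
      have hEL : E < L := lt_of_le_of_ne ((le_join_iff hL).1 le_rfl).1 fun h =>
        hBE (h ▸ ((le_join_iff hL).1 le_rfl).2)
      have h₁ := ih E hlt L hEL
      have hle : finrank ℂ (L : Submodule ℂ V) - finrank ℂ (E : Submodule ℂ V) ≤
          finrank ℂ (B : Submodule ℂ V) - finrank ℂ (A : Submodule ℂ V) := by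
        have := finrank_sup_add_le (q := (E : Submodule ℂ V))
          (show (A : Submodule ℂ V) ≤ B from hAB.le)
        rw [← hL, sup_eq_left.2 (show (A : Submodule ℂ V) ≤ E from hAE)] at this
        omega
      have h₂ : g E * f L ^
          (finrank ℂ (B : Submodule ℂ V) - finrank ℂ (A : Submodule ℂ V)) ∈ K := by
        obtain ⟨j, hj⟩ := Nat.exists_eq_add_of_le hle
        rw [hj, pow_add, ← mul_assoc]
        exact K.mul_mem_right _ h₁
      have h₃ := mul_sub_mem hsup hfg hmul E B L hL hBE
      obtain ⟨r, hr⟩ := sub_dvd_pow_sub_pow (f B) (f L)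
        (finrank ℂ (B : Submodule ℂ V) - finrank ℂ (A : Submodule ℂ V))
      have h₄ := K.add_mem (K.mul_mem_right r h₃) h₂
      rwa [mul_assoc, ← hr, ← mul_add, sub_add_cancel] at h₄

end Inversion

/-! ### The relators lie in the kernel ideal -/

section Evaluation

open Module
open scoped Classical

variable {X : Finset (Submodule ℂ V)}

/-- Polynomials in the images of the `σ_A` that represent the `c_A`. -/
def cVar (A : X) : Poly X := (exists_sum_ge_eq (MvPolynomial.X : X → Poly X)).choose A

theorem sum_cVar (A : X) : ∑ B with A ≤ B, cVar B = MvPolynomial.X A :=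
  (exists_sum_ge_eq (MvPolynomial.X : X → Poly X)).choose_spec A

theorem aeval_cVar_sum (A : X) :
    MvPolynomial.aeval cVar (∑ B with A ≤ B, MvPolynomial.X B : Poly X) =
      (MvPolynomial.X A : Poly X) := by
  rw [map_sum]
  simp only [MvPolynomial.aeval_X]
  exact sum_cVar A

variable [FiniteDimensional ℂ V] {F : Finset X}
  (hsup : SupClosed (X : Set (Submodule ℂ V))) (hX : ∀ A ∈ X, A ≠ ⊥)
  (hF : IsChain (· ≤ ·) (F : Set X))
include hsup hX hF

theorem cVar_mul_cVar_mem {A B : X} (hAB : ¬ A ≤ B) (hBA : ¬ B ≤ A) :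
    cVar A * cVar B ∈ goodIdeal F :=
  mul_mem_of_incomparable hsup sum_cVar
    (fun _ _ _ hJ => X_sub_mul_X_sub_mem_goodIdeal hX hF hJ) hAB hBA

theorem cVar_mul_X_pow_mem {A B : X} (hAB : A < B) :
    cVar A * MvPolynomial.X B ^ (finrank ℂ (B : Submodule ℂ V) - finrank ℂ (A : Submodule ℂ V)) ∈
      goodIdeal F :=
  mul_pow_mem hsup sum_cVar (fun _ _ _ hJ => X_sub_mul_X_sub_mem_goodIdeal hX hF hJ)
    (fun _ _ h => X_sub_mul_X_pow_mem_goodIdeal hX hF h) A B hAB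

theorem cVar_mem {A B : X} (hA : A ∈ F) (hAB : ¬ A ≤ B) (hBA : ¬ B ≤ A) :
    cVar B ∈ goodIdeal F := by
  have := mul_mem_of_mul_sub_mem hsup sum_cVar (z := 1) (K := goodIdeal F) (A := A)
    (fun B J hJ hB => by rw [one_mul]; exact X_sub_X_mem_goodIdeal hX hF hA hB hJ) B hAB hBA
  rwa [one_mul] at this

/-- If `X₁ ∪ X₂` is a nonempty chain, only its largest element enters the exponent, and one relation
for that element suffices. If it is not a chain, an incomparable pair already kills the product of
the `cVar A`. -/
theorem prod_cVar_mul_X_pow_mem {X₁ X₂ : Finset X} {B : X} (h₁ : X₁ ⊆ F) (hB₁ : ∀ A ∈ X₁, A < B)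
    (hB₂ : ∀ A ∈ X₂, A < B) :
    (∏ A ∈ X₂, cVar A) * MvPolynomial.X B ^ defect (X₁ ∪ X₂) B ∈ goodIdeal F := by
  have hprod : ∀ A ∈ X₂, cVar A ∣ ∏ A ∈ X₂, cVar A := fun A hA => Finset.dvd_prod_of_mem _ hA
  by_cases hch : IsChain (· ≤ ·) ((X₁ ∪ X₂ : Finset X) : Set X)
  · rcases (X₁ ∪ X₂).eq_empty_or_nonempty with h | h
    · rw [defect, h, Finset.sup_empty, finrank_bot, Nat.sub_zero]
      exact Ideal.mul_mem_left _ _ (X_pow_finrank_mem_goodIdeal hX hF B)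
    · obtain ⟨A, hA, -, hA'⟩ := exists_isGreatest_of_isChain hch h
      rw [defect, hA']
      rcases Finset.mem_union.1 hA with hA | hA
      · exact Ideal.mul_mem_left _ _ (X_pow_sub_mem_goodIdeal hX hF (h₁ hA) (hB₁ A hA))
      · exact Ideal.mem_of_dvd _ (mul_dvd_mul_right (hprod A hA) _)
          (cVar_mul_X_pow_mem hsup hX hF (hB₂ A hA))
  · refine Ideal.mul_mem_right _ _ ?_
    simp only [IsChain, Set.Pairwise] at hch
    push Not at hch
    obtain ⟨A, hA, C, hC, hne, hAC, hCA⟩ := hch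
    rcases Finset.mem_union.1 hA with hA | hA
    · rcases Finset.mem_union.1 hC with hC | hC
      · exact absurd (hF.total (h₁ hA) (h₁ hC)) (by simp [hAC, hCA])
      · exact Ideal.mem_of_dvd _ (hprod C hC) (cVar_mem hsup hX hF (h₁ hA) hAC hCA)
    · rcases Finset.mem_union.1 hC with hC | hC
      · exact Ideal.mem_of_dvd _ (hprod A hA) (cVar_mem hsup hX hF (h₁ hC) hCA hAC)
      · refine Ideal.mem_of_dvd _ ?_ (cVar_mul_cVar_mem hsup hX hF hAC hCA)
        rw [← Finset.prod_pair hne]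
        exact Finset.prod_dvd_prod_of_subset _ _ _ (by simp [Finset.insert_subset_iff, hA, hC])

end Evaluation

/-! ### Coefficients in the exterior algebra -/

section Coefficient

open Module
open scoped Classical

variable {X : Finset (Submodule ℂ V)}

/-- The functional on the exterior algebra that extracts the coefficient of `∏_{A ∈ T} e_A`. -/
def coeffExt (T : List X) : Ext X →ₗ[ℚ] ℚ :=
  ExteriorAlgebra.liftAlternating fun i =>
    if i = T.length then (Matrix.detRowAlternating (n := Fin i) (R := ℚ)).compLinearMap
      -- The default 0 is never reached, since `i = T.length` in this branch.
      (LinearMap.pi fun j : Fin i => (T[(j : ℕ)]?).elim 0 fun A => Finsupp.lapply A)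
    else 0

theorem prod_map_ι_eq (v : X → X →₀ ℚ) (L : List X) :
    (L.map fun A => ExteriorAlgebra.ι ℚ (v A)).prod =
      ExteriorAlgebra.ιMulti ℚ L.length fun i => v L[i] := by
  rw [ExteriorAlgebra.ιMulti_apply]
  congr 1
  apply List.ext_getElem <;> simp

theorem coeffExt_prod (T : List X) (v : X → X →₀ ℚ) (L : List X) :
    coeffExt T (L.map fun A => ExteriorAlgebra.ι ℚ (v A)).prod =
      if h : L.length = T.length then
        Matrix.det (Matrix.of fun i j : Fin L.length => v L[i] (T[(j : ℕ)]'(h ▸ j.2))) else 0 := by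
  rw [prod_map_ι_eq, coeffExt, ExteriorAlgebra.liftAlternating_apply_ιMulti]
  split_ifs with h
  · rw [AlternatingMap.compLinearMap_apply]
    change Matrix.det _ = _
    congr 1
    ext i j
    have hj : (j : ℕ) < T.length := h ▸ j.2
    simp [List.getElem?_eq_getElem hj]
  · simp

theorem coeffExt_prod_congr {T : List X} {v v' : X → X →₀ ℚ} (h : ∀ A ∈ T, ∀ B, v B A = v' B A)
    (L : List X) :
    coeffExt T (L.map fun A => ExteriorAlgebra.ι ℚ (v A)).prod =
      coeffExt T (L.map fun A => ExteriorAlgebra.ι ℚ (v' A)).prod := by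
  rw [coeffExt_prod, coeffExt_prod]
  split_ifs with hL
  · congr 1
    ext i j
    exact h _ (List.getElem_mem _) _
  · rfl

/-- The vector `∑_{B ⊇ A} e_B`. -/
def tauVec (A : X) : X →₀ ℚ := ∑ B with A ≤ B, Finsupp.single B 1

theorem tauVec_apply (A B : X) : tauVec A B = if A ≤ B then 1 else 0 := by
  simp only [tauVec, Finsupp.coe_finsetSum, Finset.sum_apply, Finsupp.single_apply,
    Finset.sum_ite_eq', Finset.mem_filter, Finset.mem_univ, true_and]

/-- The element `∑_{B ⊇ A} e_B` of the exterior algebra. -/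
def tauExt (A : X) : Ext X := ExteriorAlgebra.ι ℚ (tauVec A)

/-- The coefficient is the determinant of the 0-1 incidence matrix of inclusions. A nonzero term in
its expansion is a matching of `L` into `T`. -/
theorem exists_perm_of_coeffExt_ne_zero {T L : List X} (h : coeffExt T (L.map tauExt).prod ≠ 0) :
    ∃ L', L'.Perm L ∧ List.Forall₂ (· ≤ ·) L' T := by
  have h' : coeffExt T (L.map fun A => ExteriorAlgebra.ι ℚ (tauVec A)).prod ≠ 0 := h
  rw [coeffExt_prod] at h'
  split_ifs at h' with hL
  · rw [Matrix.det_apply] at h'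
    obtain ⟨π, -, hπ⟩ := Finset.exists_ne_zero_of_sum_ne_zero h'
    refine ⟨List.ofFn fun i : Fin L.length => L[π i], ?_, ?_⟩
    · have := Equiv.Perm.ofFn_comp_perm π fun i : Fin L.length => L[i]
      simpa [Function.comp_def] using this
    · rw [List.forall₂_iff_get]
      refine ⟨by simpa using hL, fun i h₁ h₂ => ?_⟩
      have h₃ : i < L.length := by simpa using h₁
      by_contra hle
      refine hπ (smul_eq_zero_of_right _ (Finset.prod_eq_zero (Finset.mem_univ ⟨i, h₃⟩) ?_))
      rw [Matrix.of_apply, tauVec_apply, if_neg]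
      simpa using hle
  · exact absurd rfl h'

theorem coeffExt_self {T : List X} (hT : T.Pairwise (· < ·)) :
    coeffExt T (T.map tauExt).prod = 1 := by
  have h' : coeffExt T (T.map fun A => ExteriorAlgebra.ι ℚ (tauVec A)).prod = 1 := by
    rw [coeffExt_prod, dif_pos rfl, Matrix.det_of_isUpperTriangular]
    · refine Finset.prod_eq_one fun i _ => ?_
      rw [Matrix.of_apply, tauVec_apply, if_pos]
      exact le_rfl
    · intro i j hij
      rw [Matrix.of_apply, tauVec_apply, if_neg]
      exact (List.pairwise_iff_getElem.1 hT _ _ _ _ hij).not_ge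
  exact h'

/-- The dimension of a member of `X`. -/
abbrev rk (A : X) : ℕ := finrank ℂ (A : Submodule ℂ V)

theorem sum_finrank_le_of_forall₂ [FiniteDimensional ℂ V] {L T : List X}
    (h : List.Forall₂ (· ≤ ·) L T) :
    (L.map rk).sum ≤
        (T.map rk).sum ∧
      ((L.map rk).sum =
        (T.map rk).sum → L = T) := by
  induction h with
  | nil => simp
  | @cons A B L T hAB _ ih =>
    have hle : rk A ≤ rk B :=
      Submodule.finrank_mono hAB
    simp only [List.map_cons, List.sum_cons]
    refine ⟨add_le_add hle ih.1, fun h => ?_⟩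
    have h₁ : rk A = rk B := by
      have := ih.1
      omega
    rw [ih.2 (by omega), Subtype.ext (Submodule.eq_of_le_of_finrank_eq hAB h₁)]

theorem sum_finrank_le_of_coeffExt_ne_zero [FiniteDimensional ℂ V] {L T : List X}
    (hL : L.Pairwise (· < ·)) (hT : T.Pairwise (· < ·)) (h : coeffExt T (L.map tauExt).prod ≠ 0) :
    (L.map rk).sum ≤
        (T.map rk).sum ∧
      ((L.map rk).sum =
        (T.map rk).sum → L = T) := by
  obtain ⟨L', hperm, hle⟩ := exists_perm_of_coeffExt_ne_zero h
  obtain ⟨h₁, h₂⟩ := sum_finrank_le_of_forall₂ hle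
  rw [(hperm.map _).sum_eq] at h₁ h₂
  refine ⟨h₁, fun h => ?_⟩
  have := h₂ h
  subst this
  exact hperm.symm.eq_of_pairwise (le := (· < ·)) (fun _ _ _ _ h h' => absurd h h'.not_gt) hL hT

end Coefficient

/-! ### Functionals on the model attached to a flag -/

section Functional

open Module
open scoped Classical

variable {X : Finset (Submodule ℂ V)}

/-- The polynomial `∑_{B ⊇ A} c_B`. -/
def sigmaPoly (A : X) : Poly X := ∑ B with A ≤ B, MvPolynomial.X B

/-- The monomial in the `τ_A` and `σ_A` given by a list and a multiset. -/
def mon (L : List X) (s : Multiset X) : Model X :=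
  toModel X ((s.map sigmaPoly).prod ⊗ₜ[ℚ] (L.map tauExt).prod)

/-- The projection of `ℚ ^ X` that keeps the coordinates in `F`. -/
def restrictVec (F : Finset X) : (X →₀ ℚ) →ₗ[ℚ] (X →₀ ℚ) :=
  Finsupp.linearCombination ℚ fun A => if A ∈ F then Finsupp.single A 1 else 0

theorem restrictVec_apply_of_mem {F : Finset X} {A : X} (hA : A ∈ F) (v : X →₀ ℚ) :
    restrictVec F v A = v A := by
  induction v using Finsupp.induction_linear with
  | zero => simp
  | add v w hv hw => simp [hv, hw]
  | single B b =>
    rw [restrictVec, Finsupp.linearCombination_single]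
    by_cases hB : B ∈ F
    · simp [hB, Finsupp.single_apply]
    · have : B ≠ A := fun h => hB (h ▸ hA)
      simp [hB, this]

theorem restrictVec_single_of_notMem {F : Finset X} {A : X} (hA : A ∉ F) :
    restrictVec F (Finsupp.single A 1) = 0 := by
  simp [restrictVec, hA]

/-- The homomorphism that evaluates the polynomial generators modulo `goodIdeal F` and kills the
exterior generators outside of `F`. -/
def evalTensor (F : Finset X) : Poly X ⊗[ℚ] Ext X →ₐ[ℚ] (Poly X ⧸ goodIdeal F) ⊗[ℚ] Ext X :=
  Algebra.TensorProduct.map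
    ((Ideal.Quotient.mkₐ ℚ (goodIdeal F)).comp (MvPolynomial.aeval cVar))
    (ExteriorAlgebra.map (restrictVec F))

theorem evalTensor_tmul (F : Finset X) (p : Poly X) (l : Ext X) :
    evalTensor F (p ⊗ₜ l) = (Ideal.Quotient.mk (goodIdeal F) (MvPolynomial.aeval cVar p)) ⊗ₜ
      ExteriorAlgebra.map (restrictVec F) l := rfl

variable [FiniteDimensional ℂ V] {F : Finset X}
  (hsup : SupClosed (X : Set (Submodule ℂ V))) (hX : ∀ A ∈ X, A ≠ ⊥)
  (hF : IsChain (· ≤ ·) (F : Set X))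
include hsup hX hF

/-- If `X₁` leaves the flag, the exterior factor is killed; if it stays inside, the polynomial
factor is in `goodIdeal F`. -/
theorem evalTensor_relator {X₁ : List X} {X₂ : Finset X} {B : X} (h₁ : ∀ A ∈ X₁, A < B)
    (h₂ : ∀ A ∈ X₂, A < B) : evalTensor F (relator X₁ X₂ B) = 0 := by
  rw [relator, evalTensor_tmul]
  by_cases h : ∀ A ∈ X₁, A ∈ F
  · have := prod_cVar_mul_X_pow_mem hsup hX hF (X₁ := X₁.toFinset) (X₂ := X₂) (B := B)
      (fun A hA => h A (List.mem_toFinset.1 hA)) (fun A hA => h₁ A (List.mem_toFinset.1 hA)) h₂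
    rw [map_mul, map_pow, aeval_cVar_sum, map_prod]
    simp only [MvPolynomial.aeval_X]
    rw [Ideal.Quotient.eq_zero_iff_mem.2 this, TensorProduct.zero_tmul]
  · push Not at h
    obtain ⟨A, hA, hAF⟩ := h
    rw [map_list_prod, List.prod_eq_zero, TensorProduct.tmul_zero]
    simp only [List.map_map, List.mem_map, Function.comp_apply]
    refine ⟨A, hA, ?_⟩
    rw [extGen, ExteriorAlgebra.map_apply_ι, restrictVec_single_of_notMem hAF, map_zero]

theorem evalTensor_eq_zero_of_mem {x : Poly X ⊗[ℚ] Ext X} (hx : x ∈ modelIdeal X) :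
    evalTensor F x = 0 := by
  have hle : TwoSidedIdeal.span (relators X) ≤ TwoSidedIdeal.ker (evalTensor F) := by
    rw [TwoSidedIdeal.span_le]
    rintro _ ⟨X₁, X₂, B, -, h₁, h₂, rfl⟩
    exact (TwoSidedIdeal.mem_ker _).2 (evalTensor_relator hsup hX hF h₁ h₂)
  exact (TwoSidedIdeal.mem_ker _).1 (hle (TwoSidedIdeal.mem_asIdeal.1 hx))

theorem exists_functional (y : Poly X) {T : List X} (hT : ∀ A ∈ T, A ∈ F) :
    ∃ θ : Model X →ₗ[ℚ] ℚ, ∀ L s, θ (mon L s) =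
      goodFun F ((s.map MvPolynomial.X).prod * y) * coeffExt T (L.map tauExt).prod := by
  let ψ : Poly X ⧸ goodIdeal F →ₗ[ℚ] ℚ :=
    ((goodIdeal F).restrictScalars ℚ).liftQ (goodFun F ∘ₗ LinearMap.mulRight ℚ y)
      (fun q hq => hq y) ∘ₗ (Submodule.Quotient.restrictScalarsEquiv ℚ (goodIdeal F)).symm
  have hψ : ∀ q, ψ (Ideal.Quotient.mk (goodIdeal F) q) = goodFun F (q * y) := fun q => rfl
  refine ⟨LinearMap.mul' ℚ ℚ ∘ₗ TensorProduct.map ψ (coeffExt T) ∘ₗ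
    (Ideal.Quotient.liftₐ (modelIdeal X) (evalTensor F)
      fun x hx => evalTensor_eq_zero_of_mem hsup hX hF hx).toLinearMap, fun L s => ?_⟩
  have h₁ : Ideal.Quotient.liftₐ (modelIdeal X) (evalTensor F)
      (fun x hx => evalTensor_eq_zero_of_mem hsup hX hF hx) (mon L s) =
      evalTensor F ((s.map sigmaPoly).prod ⊗ₜ[ℚ] (L.map tauExt).prod) := rfl
  simp only [LinearMap.comp_apply, AlgHom.toLinearMap_apply, h₁, evalTensor_tmul,
    TensorProduct.map_tmul, LinearMap.mul'_apply, hψ]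
  congr 1
  · rw [map_multiset_prod, Multiset.map_map]
    congr 4
    exact funext aeval_cVar_sum
  · rw [map_list_prod, List.map_map]
    have h₂ : (ExteriorAlgebra.map (restrictVec F) : Ext X → Ext X) ∘ tauExt =
        fun A => ExteriorAlgebra.ι ℚ (restrictVec F (tauVec A)) := by
      funext A
      exact ExteriorAlgebra.map_apply_ι _ _
    rw [h₂]
    -- Killing the coordinates outside `F` does not affect the coefficient, since it only reads
    -- coordinates in `T ⊆ F`.
    exact coeffExt_prod_congr (fun A hA B => restrictVec_apply_of_mem (hT A hA) _) L

end Functional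

/-! ### Monomials indexed by lists and multisets -/

section Monomial

open Module
open scoped Classical

variable {X : Finset (Submodule ℂ V)}

/-- The inclusion of the polynomials into the model. -/
def polyMap (X : Finset (Submodule ℂ V)) : Poly X →ₐ[ℚ] Model X :=
  (toModel X).comp Algebra.TensorProduct.includeLeft

/-- The inclusion of the exterior algebra into the model. -/
def extMap (X : Finset (Submodule ℂ V)) : Ext X →ₐ[ℚ] Model X :=
  (toModel X).comp Algebra.TensorProduct.includeRight

theorem polyMap_X (A : X) : polyMap X (MvPolynomial.X A) = c A := rfl

theorem toModel_tmul (p : Poly X) (l : Ext X) :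
    toModel X (p ⊗ₜ l) = extMap X l * polyMap X p := by
  simp only [extMap, polyMap, AlgHom.comp_apply, ← map_mul,
    Algebra.TensorProduct.includeLeft_apply, Algebra.TensorProduct.includeRight_apply,
    Algebra.TensorProduct.tmul_mul_tmul, one_mul, mul_one]

theorem commute_polyMap_extMap (p : Poly X) (l : Ext X) :
    Commute (polyMap X p) (extMap X l) := by
  rw [commute_iff_eq]
  simp only [extMap, polyMap, AlgHom.comp_apply, ← map_mul,
    Algebra.TensorProduct.includeLeft_apply, Algebra.TensorProduct.includeRight_apply,
    Algebra.TensorProduct.tmul_mul_tmul, one_mul, mul_one]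

theorem polyMap_sigmaPoly (A : X) : polyMap X (sigmaPoly A) = sigma A := by
  rw [sigmaPoly, map_sum]
  rfl

theorem tauExt_eq_sum (A : X) : tauExt A = ∑ B with A ≤ B, extGen B := by
  rw [tauExt, tauVec, map_sum]
  rfl

theorem extMap_tauExt (A : X) : extMap X (tauExt A) = tau A := by
  rw [tauExt_eq_sum, map_sum]
  rfl

theorem mon_eq (L : List X) (s : Multiset X) :
    mon L s = (L.map tau).prod * polyMap X (s.map sigmaPoly).prod := by
  rw [mon, toModel_tmul, map_list_prod, List.map_map,
    show (extMap X : Ext X → Model X) ∘ tauExt = tau from funext extMap_tauExt]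

/-- The multiset in which each `A ∈ S` has the multiplicity `m A`. -/
def expo (S : Finset X) (m : S → ℕ) : Multiset X := ∑ A : S, Multiset.replicate (m A) (A : X)

theorem mu_eq_mon (S : Finset X) (T : List X) (m : S → ℕ) : mu S T m = mon T (expo S m) := by
  have h : polyMap X ((expo S m).map sigmaPoly).prod =
      polyMap X (∏ A : S, sigmaPoly (A : X) ^ m A) := by
    congr 1
    rw [expo, ← Multiset.coe_mapAddMonoidHom, map_sum, Multiset.prod_sum]
    simp [Multiset.map_replicate]
  have h' := Finset.map_noncommProd (Finset.univ : Finset S) (fun A : S => sigmaPoly (A : X) ^ m A)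
    (fun _ _ _ _ _ => Commute.all _ _) (polyMap X)
  rw [Finset.noncommProd_eq_prod] at h'
  rw [mon_eq, h, h', mu]
  congr 1
  refine Finset.noncommProd_congr rfl (fun A _ => ?_) _
  rw [map_pow, polyMap_sigmaPoly]

theorem count_expo (S : Finset X) (m : S → ℕ) (A : X) :
    (expo S m).count A = if h : A ∈ S then m ⟨A, h⟩ else 0 := by
  rw [expo, Multiset.count_sum']
  simp only [Multiset.count_replicate]
  split_ifs with h
  · rw [Finset.sum_eq_single ⟨A, h⟩]
    · simp
    · intro B _ hB
      rw [if_neg fun h' => hB (Subtype.ext h')]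
    · simp
  · refine Finset.sum_eq_zero fun B _ => if_neg ?_
    rintro rfl
    exact h B.2

theorem mem_expo {S : Finset X} {m : S → ℕ} (hm : ∀ A, 0 < m A) {A : X} :
    A ∈ expo S m ↔ A ∈ S := by
  rw [← Multiset.count_pos, count_expo]
  split_ifs with h
  · simp [h, hm]
  · simp [h]

theorem BasicIndex.eq_of_expo_eq {r : ℕ} {t t' : BasicIndex X r} (hT : t.T = t'.T)
    (h : expo t.S t.m = expo t'.S t'.m) : t = t' := by
  have hS : t.S = t'.S := by
    ext A
    rw [← mem_expo t.m_pos, h, mem_expo t'.m_pos]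
  obtain ⟨S, T, m, _, _, hm, _, _⟩ := t
  obtain ⟨S', T', m', _, _, hm', _, _⟩ := t'
  obtain rfl : T = T' := hT
  obtain rfl : S = S' := hS
  obtain rfl : m = m' := by
    funext A
    have := congrArg (Multiset.count (A : X)) h
    simpa [count_expo] using this
  rfl

end Monomial

/-! ### Triangularity with respect to total dimension -/

section Triangular

open Module
open scoped Classical

theorem linearIndependent_of_triangular {ι M : Type*} [AddCommGroup M] [Module ℚ M] {v : ι → M}
    (W : ι → ℕ) (θ : ι → M →ₗ[ℚ] ℚ) (h₁ : ∀ i, θ i (v i) ≠ 0)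
    (h₂ : ∀ i j, θ i (v j) ≠ 0 → j ≠ i → W j < W i) : LinearIndependent ℚ v := by
  rw [linearIndependent_iff']
  intro s g hg
  suffices ∀ n, ∀ i ∈ s, W i = n → g i = 0 from fun i hi => this _ i hi rfl
  intro n
  induction n using Nat.strong_induction_on with
  | _ n ih =>
    rintro i hi rfl
    have h := congrArg (θ i) hg
    rw [map_sum, map_zero, Finset.sum_eq_single i] at h
    · rw [map_smul, smul_eq_mul] at h
      exact (mul_eq_zero.1 h).resolve_right (h₁ i)
    · intro j hj hji
      rw [map_smul, smul_eq_mul, mul_eq_zero]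
      by_contra hcon
      push Not at hcon
      exact hcon.1 (ih _ (h₂ i j hcon.2 hji) j hj rfl)
    · exact fun h => absurd hi h

variable {X : Finset (Submodule ℂ V)} {F : Finset X}

theorem part_of_subset (hX : ∀ A ∈ X, A ≠ ⊥) (hF : IsChain (· ≤ ·) (F : Set X))
    {Z : Multiset X} (hZ : ∀ A ∈ Z, A ∈ F) {A : X} (hA : A ∈ F) :
    part F A Z = Multiset.replicate (Z.count A) (A : Submodule ℂ V) := by
  have h : Z.filter (Level F A) = Z.filter (· = A) := Multiset.filter_congr fun B hB =>
    ⟨fun h => (level_self hX hF).unique hF (hZ B hB) hA h, fun h => h ▸ level_self hX hF⟩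
  rw [part, h, Multiset.filter_eq', Multiset.map_replicate]

variable [FiniteDimensional ℂ V]

theorem predecessor_finrank_lt (hX : ∀ A ∈ X, A ≠ ⊥) (hF : IsChain (· ≤ ·) (F : Set X)) (A : X) :
    finrank ℂ (predecessor F A) < rk A := by
  refine Submodule.finrank_lt_finrank_of_lt (lt_of_le_of_ne (predecessor_le A) fun h => ?_)
  exact (level_self hX hF (A := A)).2 h.ge

/-- The multiset that complements `s` to the good multiset supported on the flag `F`. -/
def complement (F : Finset X) (s : Multiset X) : Multiset X :=
  ∑ A ∈ F, Multiset.replicate (rk A - finrank ℂ (predecessor F A) - 1 - s.count A) A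

omit [FiniteDimensional ℂ V] in
theorem mem_of_mem_complement {s : Multiset X} {A : X} (h : A ∈ complement F s) : A ∈ F := by
  obtain ⟨B, hB, hA⟩ := Multiset.mem_sum.1 h
  rwa [Multiset.eq_of_mem_replicate hA]

omit [FiniteDimensional ℂ V] in
theorem count_complement (s : Multiset X) {A : X} (hA : A ∈ F) :
    (complement F s).count A = rk A - finrank ℂ (predecessor F A) - 1 - s.count A := by
  rw [complement, Multiset.count_sum', Finset.sum_eq_single A]
  · simp
  · intro B _ hBA
    rw [Multiset.count_replicate, if_neg hBA]
  · exact fun h => absurd hA h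

variable (hX : ∀ A ∈ X, A ≠ ⊥) (hF : IsChain (· ≤ ·) (F : Set X)) {s : Multiset X}
  (hs : ∀ A ∈ s, A ∈ F) (hcount : ∀ A ∈ F, s.count A + finrank ℂ (predecessor F A) < rk A)
include hX hF hs hcount

theorem good_add_complement : Good F (s + complement F s) := by
  have hZ : ∀ A ∈ s + complement F s, A ∈ F := fun A hA =>
    (Multiset.mem_add.1 hA).elim (hs A) mem_of_mem_complement
  refine ⟨fun C hC => ⟨C, hZ C hC, le_rfl⟩, fun A hA => ?_⟩
  have h := hcount A hA
  have hrk : rk A = finrank ℂ (A : Submodule ℂ V) := rfl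
  rw [part_of_subset hX hF hZ hA, Multiset.count_add, count_complement s hA,
    Multiset.card_replicate]
  exact ⟨by omega, dragon_replicate (by omega)⟩

/-- Maximality on each level forces `s'` to have exactly `s.count A` members on the level of `A`.
Replacing each member by the flag element of its level turns `s'` into `s` and can only raise
dimensions. -/
theorem sum_rk_le_of_good_add {s' : Multiset X} (h : Good F (s' + complement F s)) :
    (s'.map rk).sum ≤ (s.map rk).sum ∧ ((s'.map rk).sum = (s.map rk).sum → s' = s) := by
  have hcard : ∀ A ∈ F, (part F A s').card = s.count A := by
    intro A hA
    have h₁ := (h.2 A hA).1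
    have h₂ := hcount A hA
    have hrk : rk A = finrank ℂ (A : Submodule ℂ V) := rfl
    rw [part_add, part_of_subset hX hF (fun _ => mem_of_mem_complement) hA, Multiset.card_add,
      Multiset.card_replicate, count_complement s hA] at h₁
    omega
  have hlev : ∀ C : X, ∃ A : X, C ∈ s' → A ∈ F ∧ Level F A C := by
    intro C
    by_cases hC : C ∈ s'
    · obtain ⟨A, hA, hAC⟩ := exists_level hX hF (h.1 C (Multiset.mem_add.2 (Or.inl hC)))
      exact ⟨A, fun _ => ⟨hA, hAC⟩⟩
    · exact ⟨C, fun h => absurd h hC⟩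
  choose lev hlev using hlev
  have hmap : s'.map lev = s := by
    ext A
    rw [Multiset.count_map]
    by_cases hA : A ∈ F
    · rw [← hcard A hA, part, Multiset.card_map]
      congr 1
      refine Multiset.filter_congr fun C hC => ?_
      exact ⟨fun h => h ▸ (hlev C hC).2, fun h => h.unique hF hA (hlev C hC).1 (hlev C hC).2⟩
    · rw [Multiset.count_eq_zero_of_notMem fun h => hA (hs A h), Multiset.card_eq_zero,
        Multiset.filter_eq_nil]
      exact fun C hC h => hA (h ▸ (hlev C hC).1)
  have hle : ∀ C ∈ s', rk C ≤ rk (lev C) := fun C hC => Submodule.finrank_mono (hlev C hC).2.1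
  rw [← hmap, Multiset.map_map]
  refine ⟨Multiset.sum_map_le_sum_map _ _ hle, fun heq => ?_⟩
  have hfix : ∀ C ∈ s', lev C = C := by
    intro C hC
    obtain ⟨u, rfl⟩ := Multiset.exists_cons_of_mem hC
    have h₁ := hle C hC
    have h₂ : (u.map rk).sum ≤ (u.map (rk ∘ lev)).sum :=
      Multiset.sum_map_le_sum_map _ _ fun D hD => hle D (Multiset.mem_cons_of_mem hD)
    simp only [Multiset.map_cons, Multiset.sum_cons, Function.comp_apply] at heq
    simp only [Function.comp_def] at heq h₂
    have h₃ : rk C = rk (lev C) := by omega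
    exact (Subtype.ext (Submodule.eq_of_le_of_finrank_eq (hlev C hC).2.1 h₃)).symm
  conv_lhs => rw [← Multiset.map_id s']
  exact Multiset.map_congr rfl fun C hC => (hfix C hC).symm

end Triangular

/-! ### Linear independence of the basic monomials -/

section Independence

open Module
open scoped Classical

variable {X : Finset (Submodule ℂ V)} [FiniteDimensional ℂ V]

theorem linearIndependent_mu (hsup : SupClosed (X : Set (Submodule ℂ V)))
    (hX : ∀ A ∈ X, A ≠ ⊥) (r : ℕ) :
    LinearIndependent ℚ fun t : BasicIndex X r => mu t.S t.T t.m := by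
  have hmem : ∀ t : BasicIndex X r, ∀ A ∈ expo t.S t.m, A ∈ t.S ∪ t.T.toFinset := fun t A hA =>
    Finset.mem_union_left _ ((mem_expo t.m_pos).1 hA)
  have hcount : ∀ t : BasicIndex X r, ∀ A ∈ t.S ∪ t.T.toFinset,
      (expo t.S t.m).count A + finrank ℂ (predecessor (t.S ∪ t.T.toFinset) A) < rk A := by
    intro t A _
    rw [count_expo]
    split_ifs with h
    · have : t.m ⟨A, h⟩ < rk A - finrank ℂ (predecessor (t.S ∪ t.T.toFinset) A) := t.m_lt ⟨A, h⟩
      omega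
    · rw [zero_add]
      exact predecessor_finrank_lt hX t.flag A
  choose θ hθ using fun t : BasicIndex X r => exists_functional hsup hX t.flag
    ((complement (t.S ∪ t.T.toFinset) (expo t.S t.m)).map MvPolynomial.X).prod (T := t.T)
    (fun A hA => Finset.mem_union_right _ (List.mem_toFinset.2 hA))
  have hθ' : ∀ t t' : BasicIndex X r, θ t (mu t'.S t'.T t'.m) =
      (if Good (t.S ∪ t.T.toFinset) (expo t'.S t'.m +
        complement (t.S ∪ t.T.toFinset) (expo t.S t.m)) then 1 else 0) *
      coeffExt t.T (t'.T.map tauExt).prod := by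
    intro t t'
    rw [mu_eq_mon, hθ, ← Multiset.prod_add, ← Multiset.map_add, goodFun_prod]
  refine linearIndependent_of_triangular
    (fun t => (t.T.map rk).sum + ((expo t.S t.m).map rk).sum) θ (fun t => ?_) fun t t' h hne => ?_
  · rw [hθ', if_pos (good_add_complement hX t.flag (hmem t) (hcount t)), coeffExt_self t.sorted]
    simp
  · rw [hθ'] at h
    have hgood := left_ne_zero_of_mul h
    obtain ⟨h₁, h₂⟩ := sum_rk_le_of_good_add hX t.flag (hmem t) (hcount t)
      (by by_contra hg; exact hgood (if_neg hg))
    obtain ⟨h₃, h₄⟩ := sum_finrank_le_of_coeffExt_ne_zero t'.sorted t.sorted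
      (right_ne_zero_of_mul h)
    by_contra hlt
    exact hne (BasicIndex.eq_of_expo_eq (h₄ (by omega)) (h₂ (by omega)))

end Independence

/-! ### Relations in the model -/

section Relations

open Module
open scoped Classical

variable {X : Finset (Submodule ℂ V)}

theorem toModel_relator {X₁ : List X} {X₂ : Finset X} {B : X} (hn : X₁.Nodup)
    (h₁ : ∀ A ∈ X₁, A < B) (h₂ : ∀ A ∈ X₂, A < B) : toModel X (relator X₁ X₂ B) = 0 :=
  Ideal.Quotient.eq_zero_iff_mem.2 (TwoSidedIdeal.mem_asIdeal.2
    (TwoSidedIdeal.subset_span ⟨X₁, X₂, B, hn, h₁, h₂, rfl⟩))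

theorem prod_e_mul_prod_c_mul_sigma_pow {X₁ : List X} {X₂ : Finset X} {B : X} (hn : X₁.Nodup)
    (h₁ : ∀ A ∈ X₁, A < B) (h₂ : ∀ A ∈ X₂, A < B) :
    (X₁.map e).prod * (polyMap X (∏ A ∈ X₂, MvPolynomial.X A) *
      sigma B ^ defect (X₁.toFinset ∪ X₂) B) = 0 := by
  have h := toModel_relator hn h₁ h₂
  have h' : (extMap X : Ext X → Model X) ∘ extGen = e := rfl
  rwa [relator, toModel_tmul, map_list_prod, List.map_map, h', map_mul, map_pow,
    show polyMap X (∑ C with B ≤ C, MvPolynomial.X C) = sigma B from polyMap_sigmaPoly B] at h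

theorem defect_of_sup_eq {Y : Finset X} {q : Submodule ℂ V}
    (h : (Y.sup fun A => (A : Submodule ℂ V)) = q) (B : X) :
    defect Y B = rk B - finrank ℂ q := by
  rw [defect, h]

theorem sigma_pow_finrank (B : X) : sigma B ^ rk B = 0 := by
  have h := prod_e_mul_prod_c_mul_sigma_pow (X₁ := []) (X₂ := ∅) (B := B) (by simp) (by simp)
    (by simp)
  rw [defect_of_sup_eq (q := ⊥) (by simp)] at h
  simpa using h

theorem c_mul_sigma_pow {A B : X} (hAB : A < B) : c A * sigma B ^ (rk B - rk A) = 0 := by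
  have h := prod_e_mul_prod_c_mul_sigma_pow (X₁ := []) (X₂ := {A}) (B := B) (by simp) (by simp)
    (by simpa using hAB)
  rw [defect_of_sup_eq (q := A) (by simp)] at h
  simpa [polyMap_X] using h

theorem e_mul_sigma_pow {A B : X} (hAB : A < B) : e A * sigma B ^ (rk B - rk A) = 0 := by
  have h := prod_e_mul_prod_c_mul_sigma_pow (X₁ := [A]) (X₂ := ∅) (B := B) (by simp)
    (by simpa using hAB) (by simp)
  rw [defect_of_sup_eq (q := A) (by simp)] at h
  simpa using h

variable (hsup : SupClosed (X : Set (Submodule ℂ V)))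
include hsup

theorem exists_join_lt {A B : X} (hAB : ¬ A ≤ B) (hBA : ¬ B ≤ A) :
    ∃ J : X, (J : Submodule ℂ V) = (A : Submodule ℂ V) ⊔ B ∧ A < J ∧ B < J := by
  obtain ⟨J, hJ⟩ := exists_join hsup A B
  obtain ⟨h₁, h₂⟩ := (le_join_iff hJ).1 le_rfl
  exact ⟨J, hJ, lt_of_le_of_ne h₁ fun h => hBA (h ▸ h₂), lt_of_le_of_ne h₂ fun h => hAB (h ▸ h₁)⟩

/-- Take the relator at the join of `A` and `B`: its exponent is 0, so the power of `σ` disappears.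
-/
theorem c_mul_c {A B : X} (hAB : ¬ A ≤ B) (hBA : ¬ B ≤ A) : c A * c B = 0 := by
  obtain ⟨J, hJ, hA, hB⟩ := exists_join_lt hsup hAB hBA
  have hne : A ≠ B := fun h => hAB h.le
  have h := prod_e_mul_prod_c_mul_sigma_pow (X₁ := []) (X₂ := {A, B}) (B := J) (by simp) (by simp)
    (by simp [hA, hB])
  rw [defect_of_sup_eq (q := J) (by simp [hJ]), Nat.sub_self] at h
  simpa [Finset.prod_pair hne, polyMap_X] using h

theorem e_mul_c {A B : X} (hAB : ¬ A ≤ B) (hBA : ¬ B ≤ A) : e A * c B = 0 := by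
  obtain ⟨J, hJ, hA, hB⟩ := exists_join_lt hsup hAB hBA
  have h := prod_e_mul_prod_c_mul_sigma_pow (X₁ := [A]) (X₂ := {B}) (B := J) (by simp)
    (by simp [hA]) (by simp [hB])
  rw [defect_of_sup_eq (q := J) (by simp [hJ]), Nat.sub_self] at h
  simpa [polyMap_X] using h

theorem e_mul_e {A B : X} (hAB : ¬ A ≤ B) (hBA : ¬ B ≤ A) : e A * e B = 0 := by
  obtain ⟨J, hJ, hA, hB⟩ := exists_join_lt hsup hAB hBA
  have hne : A ≠ B := fun h => hAB h.le
  have h := prod_e_mul_prod_c_mul_sigma_pow (X₁ := [A, B]) (X₂ := ∅) (B := J) (by simp [hne])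
    (by simp [hA, hB]) (by simp)
  rw [defect_of_sup_eq (q := J) (by simp [hJ]), Nat.sub_self] at h
  simpa using h

omit hsup in
-- Expand `(∑_{≥A} u - ∑_{≥J} u) * (∑_{≥C} w - ∑_{≥J} w)`: the remaining indices `D ≥ A` and `E ≥
-- C`, neither above `J`, are incomparable, so every term vanishes.
theorem sum_mul_sum_eq {R : Type*} [Ring R] {u w : X → R}
    (h : ∀ A B, ¬ A ≤ B → ¬ B ≤ A → u A * w B = 0) {A C J : X}
    (hJ : (J : Submodule ℂ V) = (A : Submodule ℂ V) ⊔ C) :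
    (∑ B with A ≤ B, u B) * (∑ B with C ≤ B, w B) =
      (∑ B with A ≤ B, u B) * (∑ B with J ≤ B, w B) +
        (∑ B with J ≤ B, u B) * (∑ B with C ≤ B, w B) -
          (∑ B with J ≤ B, u B) * (∑ B with J ≤ B, w B) := by
  obtain ⟨hA, hC⟩ := (le_join_iff hJ).1 le_rfl
  have h₁ : (∑ B with A ≤ B, u B - ∑ B with J ≤ B, u B) *
      (∑ B with C ≤ B, w B - ∑ B with J ≤ B, w B) = 0 := by
    rw [sum_ge_sub_sum_ge u hA, sum_ge_sub_sum_ge w hC, Finset.sum_mul_sum]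
    refine Finset.sum_eq_zero fun D hD => Finset.sum_eq_zero fun E hE => ?_
    obtain ⟨-, hAD, hJD⟩ := Finset.mem_filter.1 hD
    obtain ⟨-, hCE, hJE⟩ := Finset.mem_filter.1 hE
    exact h D E (fun hDE => hJE ((le_join_iff hJ).2 ⟨hAD.trans hDE, hCE⟩))
      fun hED => hJD ((le_join_iff hJ).2 ⟨hAD, hCE.trans hED⟩)
  rw [mul_sub, sub_mul, sub_mul] at h₁
  rw [← sub_eq_zero, ← h₁]
  abel

/-- The difference is a sum over `E ≥ A` not above `B`. Against `u E` one may replace `σ_B` by `σ_J`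
with `J = E ⊔ B`, and `dim J - dim E` does not exceed the exponent. With `u` equal to `c` or `e`
this moves a factor `σ_A` or `τ_A` up to `B`. -/
theorem sum_mul_sigma_pow [FiniteDimensional ℂ V] {u : X → Model X}
    (h₁ : ∀ A B, ¬ A ≤ B → ¬ B ≤ A → u A * c B = 0)
    (h₂ : ∀ A B, A < B → u A * sigma B ^ (rk B - rk A) = 0) {A B : X} (hAB : A < B) :
    (∑ D with A ≤ D, u D) * sigma B ^ (rk B - rk A) =
      (∑ D with B ≤ D, u D) * sigma B ^ (rk B - rk A) := by
  rw [← sub_eq_zero, ← sub_mul, sum_ge_sub_sum_ge u hAB.le, Finset.sum_mul]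
  refine Finset.sum_eq_zero fun E hE => ?_
  obtain ⟨-, hAE, hBE⟩ := Finset.mem_filter.1 hE
  obtain ⟨J, hJ⟩ := exists_join hsup E B
  obtain ⟨hEJ, hBJ⟩ := (le_join_iff hJ).1 le_rfl
  have hlt : E < J := lt_of_le_of_ne hEJ fun h => hBE (h ▸ hBJ)
  have hswap : u E * sigma B = u E * sigma J := by
    rw [← sub_eq_zero, ← mul_sub, sigma, sigma, sum_ge_sub_sum_ge c hBJ, Finset.mul_sum]
    refine Finset.sum_eq_zero fun D hD => ?_
    obtain ⟨-, hBD, hJD⟩ := Finset.mem_filter.1 hD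
    exact h₁ E D (fun h => hJD ((le_join_iff hJ).2 ⟨h, hBD⟩)) fun h => hBE (hBD.trans h)
  have hpow : ∀ k, u E * sigma B ^ k = u E * sigma J ^ k := by
    intro k
    induction k with
    | zero => simp
    | succ k ih =>
      rw [pow_succ, ← mul_assoc, ih, mul_assoc, ((commute_sigma J B).pow_left k).eq, ← mul_assoc,
        hswap, mul_assoc, pow_succ']
  have hle : rk J - rk E ≤ rk B - rk A := by
    have := finrank_sup_add_le (q := (E : Submodule ℂ V)) (show (A : Submodule ℂ V) ≤ B from hAB.le)
    rw [← hJ, sup_eq_left.2 (show (A : Submodule ℂ V) ≤ E from hAE)] at this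
    simp only [rk]
    omega
  obtain ⟨j, hj⟩ := Nat.exists_eq_add_of_le hle
  rw [hpow, hj, pow_add, ← mul_assoc, h₂ E J hlt, zero_mul]

end Relations

/-! ### Straightening: the basic monomials span -/

section Straightening

open Module
open scoped Classical

variable {X : Finset (Submodule ℂ V)}

theorem mon_cons_left (A : X) (L : List X) (s : Multiset X) : mon (A :: L) s = tau A * mon L s := by
  simp only [mon_eq, List.map_cons, List.prod_cons, mul_assoc]

theorem mon_cons_right (A : X) (L : List X) (s : Multiset X) :
    mon L (A ::ₘ s) = sigma A * mon L s := by
  have h : (L.map tau).prod = extMap X (L.map tauExt).prod := by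
    rw [map_list_prod, List.map_map,
      show (extMap X : Ext X → Model X) ∘ tauExt = tau from funext extMap_tauExt]
  rw [mon_eq, mon_eq, Multiset.map_cons, Multiset.prod_cons, map_mul, ← polyMap_sigmaPoly, h,
    ← mul_assoc, ← (commute_polyMap_extMap _ _).eq, mul_assoc]

theorem mon_replicate_add (k : ℕ) (B : X) (L : List X) (s : Multiset X) :
    mon L (Multiset.replicate k B + s) = sigma B ^ k * mon L s := by
  induction k with
  | zero => simp
  | succ k ih => rw [Multiset.replicate_succ, Multiset.cons_add, mon_cons_right, ih, ← mul_assoc,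
      pow_succ']

theorem sigma_mul_tau (A B : X) : sigma A * tau B = tau B * sigma A := by
  rw [← polyMap_sigmaPoly, ← extMap_tauExt]
  exact (commute_polyMap_extMap _ _).eq

theorem tau_mul_self (A : X) : tau A * tau A = 0 := by
  rw [← extMap_tauExt, ← map_mul, tauExt, ExteriorAlgebra.ι_sq_zero, map_zero]

theorem tau_mul_tau_swap (A B : X) : tau A * tau B = -(tau B * tau A) := by
  rw [← extMap_tauExt, ← extMap_tauExt, ← map_mul, ← map_mul, ← map_neg, tauExt, tauExt,
    eq_neg_of_add_eq_zero_left (ExteriorAlgebra.ι_add_mul_swap _ _)]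

theorem mon_perm {L L' : List X} (h : L.Perm L') (s : Multiset X) :
    mon L s = mon L' s ∨ mon L s = -mon L' s := by
  induction h with
  | nil => exact Or.inl rfl
  | cons A _ ih => rcases ih with ih | ih <;> simp [mon_cons_left, ih]
  | swap A B L =>
    right
    rw [mon_cons_left, mon_cons_left, mon_cons_left, mon_cons_left, ← mul_assoc, tau_mul_tau_swap,
      neg_mul, mul_assoc]
  | trans _ _ ih₁ ih₂ => rcases ih₁ with h₁ | h₁ <;> rcases ih₂ with h₂ | h₂ <;> simp [h₁, h₂]

theorem mon_mem_of_perm {N : Submodule ℚ (Model X)} {L L' : List X} (h : L.Perm L')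
    {s : Multiset X} (hN : mon L' s ∈ N) : mon L s ∈ N := by
  rcases mon_perm h s with h | h
  · rwa [h]
  · rw [h]
    exact N.neg_mem hN

theorem exists_pairwise_lt_perm [FiniteDimensional ℂ V] {L : List X} (hn : L.Nodup)
    (hL : ∀ A ∈ L, ∀ B ∈ L, A ≤ B ∨ B ≤ A) : ∃ T : List X, T.Perm L ∧ T.Pairwise (· < ·) := by
  -- Sorting by dimension uses a total relation on all of `X`; on a chain it agrees with inclusion.
  let R : X → X → Prop := fun A B => rk A ≤ rk B
  have : Std.Total R := ⟨fun A B => le_total (rk A) (rk B)⟩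
  have : IsTrans X R := ⟨fun A B C => le_trans⟩
  have hperm := List.perm_insertionSort R L
  refine ⟨L.insertionSort R, hperm, ?_⟩
  have h₁ : (L.insertionSort R).Pairwise R := List.pairwise_insertionSort R L
  have h₂ : (L.insertionSort R).Pairwise (· ≠ ·) := hperm.nodup_iff.2 hn
  refine (h₁.and h₂).imp_of_mem fun {A B} hA hB ⟨hR, hne⟩ => ?_
  refine lt_of_le_of_ne ?_ hne
  rcases hL A (hperm.mem_iff.1 hA) B (hperm.mem_iff.1 hB) with h | h
  · exact h
  · exact (Subtype.ext (Submodule.eq_of_le_of_finrank_le h hR)).ge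

/-- The total dimension of the factors of a monomial. -/
def weight (L : List X) (s : Multiset X) : ℕ := (L.map rk).sum + (s.map rk).sum

theorem weight_perm {L L' : List X} (h : L.Perm L') (s : Multiset X) :
    weight L s = weight L' s := by
  rw [weight, weight, (h.map rk).sum_eq]

theorem weight_le [FiniteDimensional ℂ V] (L : List X) (s : Multiset X) :
    weight L s ≤ (L.length + 2 * s.card) * finrank ℂ V := by
  have h₁ : (L.map rk).sum ≤ L.length * finrank ℂ V := by
    have := List.sum_le_card_nsmul (L.map rk) (finrank ℂ V) (by
      simp only [List.mem_map]
      rintro _ ⟨A, -, rfl⟩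
      exact Submodule.finrank_le _)
    simpa using this
  have h₂ : (s.map rk).sum ≤ s.card * finrank ℂ V := by
    have := Multiset.sum_le_card_nsmul (s.map rk) (finrank ℂ V) (by
      simp only [Multiset.mem_map]
      rintro _ ⟨A, -, rfl⟩
      exact Submodule.finrank_le _)
    simpa using this
  rw [weight]
  nlinarith

variable [FiniteDimensional ℂ V] (hsup : SupClosed (X : Set (Submodule ℂ V)))

include hsup in
-- One straightening step. A monomial that is not basic up to sign has an incomparable pair of
-- factors, a repeated `τ`, or too large an exponent; each defect makes it vanish or rewrites it in
-- larger weight.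
theorem mon_mem_of_weight_lt {r : ℕ} {L : List X} {s : Multiset X} (hr : L.length + 2 * s.card = r)
    {N : Submodule ℚ (Model X)} (hN : ∀ t : BasicIndex X r, mu t.S t.T t.m ∈ N)
    (ih : ∀ L' s', L'.length + 2 * s'.card = r → weight L s < weight L' s' → mon L' s' ∈ N) :
    mon L s ∈ N := by
  by_cases h₁ : ∃ A ∈ s, ∃ C ∈ s, ¬ A ≤ C ∧ ¬ C ≤ A
  · obtain ⟨A, hA, C, hC, hAC, hCA⟩ := h₁
    obtain ⟨J, hJ, hAJ, hCJ⟩ := exists_join_lt hsup hAC hCA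
    obtain ⟨s, rfl⟩ := Multiset.exists_cons_of_mem hA
    obtain ⟨s, rfl⟩ := Multiset.exists_cons_of_mem
      ((Multiset.mem_cons.1 hC).resolve_left fun h => hCA h.le)
    have hA' : rk A < rk J := finrank_lt_of_lt hAJ
    have hC' : rk C < rk J := finrank_lt_of_lt hCJ
    have key : mon L (A ::ₘ C ::ₘ s) = mon L (A ::ₘ J ::ₘ s) + mon L (J ::ₘ C ::ₘ s) -
        mon L (J ::ₘ J ::ₘ s) := by
      simp only [mon_cons_right, ← mul_assoc, ← add_mul, ← sub_mul]
      rw [sigma, sigma, sum_mul_sum_eq (fun _ _ => c_mul_c hsup) hJ, sigma]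
    simp only [Multiset.card_cons] at hr
    rw [key]
    refine N.sub_mem (N.add_mem ?_ ?_) ?_ <;>
      refine ih _ _ (by simpa using hr) ?_ <;>
      simp only [weight, Multiset.map_cons, Multiset.sum_cons] <;>
      omega
  by_cases h₂ : ∃ A ∈ L, ∃ C ∈ s, ¬ A ≤ C ∧ ¬ C ≤ A
  · obtain ⟨A, hA, C, hC, hAC, hCA⟩ := h₂
    obtain ⟨J, hJ, hAJ, hCJ⟩ := exists_join_lt hsup hAC hCA
    obtain ⟨s, rfl⟩ := Multiset.exists_cons_of_mem hC
    have hperm := List.perm_cons_erase hA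
    refine mon_mem_of_perm hperm ?_
    rw [weight_perm hperm] at ih
    rw [hperm.length_eq] at hr
    have hA' : rk A < rk J := finrank_lt_of_lt hAJ
    have hC' : rk C < rk J := finrank_lt_of_lt hCJ
    have key : ∀ L, mon (A :: L) (C ::ₘ s) = mon (A :: L) (J ::ₘ s) + mon (J :: L) (C ::ₘ s) -
        mon (J :: L) (J ::ₘ s) := by
      intro L
      simp only [mon_cons_right, mon_cons_left, ← mul_assoc, ← add_mul, ← sub_mul, sigma_mul_tau]
      rw [tau, sigma, sum_mul_sum_eq (fun _ _ => e_mul_c hsup) hJ, tau, sigma]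
    simp only [Multiset.card_cons, List.length_cons] at hr
    rw [key]
    refine N.sub_mem (N.add_mem ?_ ?_) ?_ <;>
      refine ih _ _ (by simpa using hr) ?_ <;>
      simp only [weight, Multiset.map_cons, Multiset.sum_cons, List.map_cons, List.sum_cons] <;>
      omega
  by_cases h₃ : ∃ A ∈ L, ∃ C ∈ L, ¬ A ≤ C ∧ ¬ C ≤ A
  · obtain ⟨A, hA, C, hC, hAC, hCA⟩ := h₃
    obtain ⟨J, hJ, hAJ, hCJ⟩ := exists_join_lt hsup hAC hCA
    have hC' : C ∈ L.erase A := (List.mem_erase_of_ne fun h => hCA h.le).2 hC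
    have hperm := (List.perm_cons_erase hA).trans ((List.perm_cons_erase hC').cons A)
    refine mon_mem_of_perm hperm ?_
    rw [weight_perm hperm] at ih
    rw [hperm.length_eq] at hr
    have hA' : rk A < rk J := finrank_lt_of_lt hAJ
    have hC' : rk C < rk J := finrank_lt_of_lt hCJ
    have key : ∀ L, mon (A :: C :: L) s = mon (A :: J :: L) s + mon (J :: C :: L) s -
        mon (J :: J :: L) s := by
      intro L
      simp only [mon_cons_left, ← mul_assoc, ← add_mul, ← sub_mul]
      rw [tau, tau, sum_mul_sum_eq (fun _ _ => e_mul_e hsup) hJ, tau]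
    simp only [List.length_cons] at hr
    rw [key]
    refine N.sub_mem (N.add_mem ?_ ?_) ?_ <;>
      refine ih _ _ (by simpa using hr) ?_ <;>
      simp only [weight, List.map_cons, List.sum_cons] <;>
      omega
  by_cases hn : L.Nodup
  swap
  · obtain ⟨A, hA⟩ := List.exists_duplicate_iff_not_nodup.2 hn
    obtain ⟨L', hL'⟩ := (List.duplicate_iff_sublist.1 hA).exists_perm_append
    refine mon_mem_of_perm hL' ?_
    rw [List.cons_append, List.cons_append, mon_cons_left, mon_cons_left, ← mul_assoc,
      tau_mul_self, zero_mul]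
    exact N.zero_mem
  push Not at h₁ h₂ h₃
  obtain ⟨T, hTL, hT⟩ := exists_pairwise_lt_perm hn fun A hA B hB =>
    or_iff_not_imp_left.2 (h₃ A hA B hB)
  refine mon_mem_of_perm hTL.symm ?_
  rw [← weight_perm hTL] at ih
  rw [← hTL.length_eq] at hr
  have hflag : IsChain (· ≤ ·) ((s.toFinset ∪ T.toFinset : Finset X) : Set X) := by
    intro A hA B hB _
    simp only [Finset.coe_union, Set.mem_union, Finset.mem_coe, Multiset.mem_toFinset,
      List.mem_toFinset, hTL.mem_iff] at hA hB
    rcases hA with hA | hA <;> rcases hB with hB | hB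
    · exact or_iff_not_imp_left.2 (h₁ A hA B hB)
    · exact (or_iff_not_imp_left.2 (h₂ B hB A hA)).symm
    · exact or_iff_not_imp_left.2 (h₂ A hA B hB)
    · exact or_iff_not_imp_left.2 (h₃ A hA B hB)
  by_cases hlt : ∀ A ∈ s, s.count A <
      rk A - finrank ℂ (predecessor (s.toFinset ∪ T.toFinset) A)
  · have hexpo : expo s.toFinset (fun A => s.count (A : X)) = s := by
      ext A
      rw [count_expo]
      split_ifs with h
      · rfl
      · exact (Multiset.count_eq_zero_of_notMem fun h' => h (Multiset.mem_toFinset.2 h')).symm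
    have hcard : ∑ A : s.toFinset, s.count (A : X) = s.card := by
      rw [Finset.sum_coe_sort s.toFinset fun A => s.count A, Multiset.toFinset_sum_count_eq]
    have := hN ⟨s.toFinset, T, fun A => s.count (A : X), hT, hflag,
      fun A => Multiset.count_pos.2 (Multiset.mem_toFinset.1 A.2),
      fun A => hlt A (Multiset.mem_toFinset.1 A.2), by rw [hcard, hr]⟩
    rwa [mu_eq_mon, hexpo] at this
  · push Not at hlt
    obtain ⟨A, hA, hle⟩ := hlt
    rcases predecessor_cases hflag A with hp | ⟨B, hB, hBA, hp⟩
    · rw [hp, finrank_bot, Nat.sub_zero, Multiset.le_count_iff_replicate_le] at hle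
      obtain ⟨s', rfl⟩ := Multiset.le_iff_exists_add.1 hle
      rw [mon_replicate_add, sigma_pow_finrank, zero_mul]
      exact N.zero_mem
    · rw [hp] at hle
      change rk A - rk B ≤ _ at hle
      rw [Multiset.le_count_iff_replicate_le] at hle
      obtain ⟨s', rfl⟩ := Multiset.le_iff_exists_add.1 hle
      have hrk : rk B < rk A := finrank_lt_of_lt hBA
      -- The predecessor `B` occurs as a `σ`-factor or as a `τ`-factor. In either case the power of
      -- `σ_A` lets that factor be replaced by the one at `A`.
      by_cases hBs : B ∈ s'
      · obtain ⟨s, rfl⟩ := Multiset.exists_cons_of_mem hBs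
        have key : mon T (Multiset.replicate (rk A - rk B) A + B ::ₘ s) =
            mon T (Multiset.replicate (rk A - rk B) A + A ::ₘ s) := by
          rw [Multiset.add_cons, Multiset.add_cons, mon_cons_right, mon_cons_right,
            mon_replicate_add, ← mul_assoc, ← mul_assoc]
          congr 1
          exact sum_mul_sigma_pow hsup (fun _ _ => c_mul_c hsup) (fun _ _ => c_mul_sigma_pow) hBA
        have hm := ih T (Multiset.replicate (rk A - rk B) A + A ::ₘ s) (by simpa using hr) (by
          simp only [weight, Multiset.map_add, Multiset.map_cons, Multiset.sum_add,
            Multiset.sum_cons]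
          omega)
        exact key ▸ hm
      · have hBT : B ∈ T := by
          rcases Finset.mem_union.1 hB with h | h
          · rcases Multiset.mem_add.1 (Multiset.mem_toFinset.1 h) with h | h
            · exact absurd (Multiset.eq_of_mem_replicate h) hBA.ne
            · exact absurd h hBs
          · exact List.mem_toFinset.1 h
        have hperm := List.perm_cons_erase hBT
        refine mon_mem_of_perm hperm ?_
        have key : ∀ L, mon (B :: L) (Multiset.replicate (rk A - rk B) A + s') =
            mon (A :: L) (Multiset.replicate (rk A - rk B) A + s') := by
          intro L
          rw [mon_cons_left, mon_cons_left, mon_replicate_add, ← mul_assoc, ← mul_assoc]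
          congr 1
          exact sum_mul_sigma_pow hsup (fun _ _ => e_mul_c hsup) (fun _ _ => e_mul_sigma_pow) hBA
        have hm := ih (A :: T.erase B) (Multiset.replicate (rk A - rk B) A + s') (by
          rw [← hr, hperm.length_eq, List.length_cons, List.length_cons]) (by
          rw [weight_perm hperm]
          simp only [weight, List.map_cons, List.sum_cons]
          omega)
        exact (key _) ▸ hm

include hsup in
theorem mon_mem_span {r : ℕ} {L : List X} {s : Multiset X} (hr : L.length + 2 * s.card = r) :
    mon L s ∈ Submodule.span ℚ (Set.range fun t : BasicIndex X r => mu t.S t.T t.m) := by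
  -- Induction on how far the weight is from its upper bound `r * dim V`.
  suffices ∀ n L s, L.length + 2 * s.card = r → r * finrank ℂ V ≤ n + weight L s →
      mon L s ∈ Submodule.span ℚ (Set.range fun t : BasicIndex X r => mu t.S t.T t.m) from
    this _ L s hr (Nat.le_add_right _ _)
  intro n
  induction n with
  | zero =>
    intro L s hr hn
    refine mon_mem_of_weight_lt hsup hr (fun t => Submodule.subset_span ⟨t, rfl⟩)
      fun L' s' hr' hlt => ?_
    have := weight_le L' s'
    rw [hr'] at this
    omega
  | succ n ih =>
    intro L s hr hn
    exact mon_mem_of_weight_lt hsup hr (fun t => Submodule.subset_span ⟨t, rfl⟩)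
      fun L' s' hr' hlt => ih L' s' hr' (by omega)

end Straightening

/-! ### Homogeneous components are spanned by monomials in `σ` and `τ` -/

section Degree

open Module
open scoped Classical Pointwise

variable {X : Finset (Submodule ℂ V)}

theorem mem_span_sum_ge {M : Type*} [AddCommGroup M] [Module ℚ M] (g : X → M) (A : X) :
    g A ∈ Submodule.span ℚ (Set.range fun A => ∑ B with A ≤ B, g B) := by
  induction A using (wellFounded_gt (α := X)).induction with
  | _ A ih =>
    have h : ∑ B with A ≤ B, g B ∈ Submodule.span ℚ (Set.range fun A => ∑ B with A ≤ B, g B) :=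
      Submodule.subset_span ⟨A, rfl⟩
    rw [← Finset.add_sum_erase _ g (Finset.mem_filter.2 ⟨Finset.mem_univ A, le_rfl⟩)] at h
    refine (Submodule.add_mem_iff_left _ (Submodule.sum_mem _ fun B hB => ?_)).1 h
    exact ih B (lt_of_le_of_ne (Finset.mem_filter.1 (Finset.mem_of_mem_erase hB)).2
      (Finset.ne_of_mem_erase hB).symm)

theorem span_range_sum_ge {M : Type*} [AddCommGroup M] [Module ℚ M] (g : X → M) :
    Submodule.span ℚ (Set.range fun A => ∑ B with A ≤ B, g B) =
      Submodule.span ℚ (Set.range g) := by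
  refine le_antisymm (Submodule.span_le.2 ?_) (Submodule.span_le.2 ?_)
  · rintro _ ⟨A, rfl⟩
    exact Submodule.sum_mem _ fun B _ => Submodule.subset_span ⟨B, rfl⟩
  · rintro _ ⟨A, rfl⟩
    exact mem_span_sum_ge g A

/-- The linear forms are spanned by the `c_A`, hence by the `σ_A`, which differ from them by a
unitriangular change of basis; degree `i` is the `i`-th power of that span. -/
theorem homogeneousSubmodule_eq_span_pow (i : ℕ) :
    MvPolynomial.homogeneousSubmodule X ℚ i =
      Submodule.span ℚ (Set.range (sigmaPoly : X → Poly X)) ^ i := by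
  rw [← MvPolynomial.homogeneousSubmodule_one_pow, MvPolynomial.homogeneousSubmodule_one_eq_span_X,
    ← span_range_sum_ge]
  rfl

theorem exteriorPower_eq_span_pow (j : ℕ) :
    (⋀[ℚ]^j (X →₀ ℚ) : Submodule ℚ (Ext X)) =
      Submodule.span ℚ (Set.range (tauExt : X → Ext X)) ^ j := by
  have h₁ : (tauExt : X → Ext X) = fun A => ∑ B with A ≤ B, extGen B := funext tauExt_eq_sum
  have h₂ : Submodule.span ℚ (Set.range (extGen : X → Ext X)) =
      LinearMap.range (ExteriorAlgebra.ι ℚ : (X →₀ ℚ) →ₗ[ℚ] Ext X) := by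
    rw [← Finsupp.range_linearCombination]
    congr 1
    ext A
    simp [extGen]
  rw [h₁, span_range_sum_ge, h₂]

theorem exists_list_of_mem_pow {R : Type*} [Monoid R] {u : X → R} {j : ℕ} {x : R}
    (hx : x ∈ Set.range u ^ j) : ∃ L : List X, L.length = j ∧ x = (L.map u).prod := by
  obtain ⟨f, rfl⟩ := Set.mem_pow.1 hx
  choose g hg using fun i => (f i).2
  refine ⟨List.ofFn g, by simp, ?_⟩
  rw [List.map_ofFn]
  congr 2
  exact funext fun i => (hg i).symm

theorem mon_mem_modelDegree (L : List X) (s : Multiset X) :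
    mon L s ∈ modelDegree X (L.length + 2 * s.card) := by
  refine Submodule.mem_map_of_mem (f := (toModel X).toLinearMap) ?_
  refine Submodule.mem_iSup_of_mem s.card (Submodule.mem_iSup_of_mem L.length
    (Submodule.mem_iSup_of_mem (add_comm _ _) (Submodule.apply_mem_map₂ _ ?_ ?_)))
  · rw [homogeneousSubmodule_eq_span_pow]
    induction s using Multiset.induction_on with
    | empty =>
      rw [Multiset.map_zero, Multiset.prod_zero, Multiset.card_zero, pow_zero]
      exact Submodule.one_le.1 le_rfl
    | cons A s ih =>
      rw [Multiset.map_cons, Multiset.prod_cons, Multiset.card_cons, pow_succ']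
      exact Submodule.mul_mem_mul (Submodule.subset_span ⟨A, rfl⟩) ih
  · rw [exteriorPower_eq_span_pow]
    induction L with
    | nil => simp
    | cons A L ih =>
      rw [List.map_cons, List.prod_cons, List.length_cons, pow_succ']
      exact Submodule.mul_mem_mul (Submodule.subset_span ⟨A, rfl⟩) ih

theorem modelDegree_le {r : ℕ} {N : Submodule ℚ (Model X)}
    (hN : ∀ (L : List X) (s : Multiset X), L.length + 2 * s.card = r → mon L s ∈ N) :
    modelDegree X r ≤ N := by
  rw [modelDegree, Submodule.map_le_iff_le_comap, tensorDegree]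
  refine iSup_le fun i => iSup_le fun j => iSup_le fun hij => ?_
  rw [homogeneousSubmodule_eq_span_pow, exteriorPower_eq_span_pow, Submodule.span_pow,
    Submodule.span_pow, Submodule.map₂_span_span, Submodule.span_le]
  rintro _ ⟨p, hp, l, hl, rfl⟩
  obtain ⟨L₁, hL₁, rfl⟩ := exists_list_of_mem_pow hp
  obtain ⟨L₂, hL₂, rfl⟩ := exists_list_of_mem_pow hl
  have := hN L₂ L₁ (by rw [Multiset.coe_card, hL₁, hL₂, add_comm, hij])
  rwa [mon, Multiset.map_coe, Multiset.prod_coe] at this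

theorem mu_mem_modelDegree {r : ℕ} (t : BasicIndex X r) :
    mu t.S t.T t.m ∈ modelDegree X r := by
  have h : (expo t.S t.m).card = ∑ A, t.m A := by
    simp [expo]
  rw [mu_eq_mon]
  have := mon_mem_modelDegree t.T (expo t.S t.m)
  rwa [h, t.degree] at this

theorem supClosed_sums (𝒜 : Finset (Submodule ℂ V)) :
    SupClosed (sums 𝒜 : Set (Submodule ℂ V)) := by
  intro A hA B hB
  simp only [sums, Finset.coe_image, Set.mem_image, Finset.mem_coe, Finset.mem_filter,
    Finset.mem_powerset] at hA hB ⊢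
  obtain ⟨F, ⟨hF, hF'⟩, rfl⟩ := hA
  obtain ⟨G, ⟨hG, -⟩, rfl⟩ := hB
  exact ⟨F ∪ G, ⟨Finset.union_subset hF hG, hF'.mono Finset.subset_union_left⟩, Finset.sup_union⟩

theorem ne_bot_of_mem_sums {𝒜 : Finset (Submodule ℂ V)} (h𝒜 : ∀ A ∈ 𝒜, A ≠ ⊥) :
    ∀ A ∈ sums 𝒜, A ≠ ⊥ := by
  intro A hA
  simp only [sums, Finset.mem_image, Finset.mem_filter, Finset.mem_powerset] at hA
  obtain ⟨F, ⟨hF, B, hB⟩, rfl⟩ := hA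
  exact ne_bot_of_le_ne_bot (h𝒜 B (hF hB)) (Finset.le_sup (f := id) hB)

end Degree

end SubspaceModel

end

/-! ### The basis theorem -/

theorem proposition3p1 {V : Type*} [AddCommGroup V] [Module ℂ V] [FiniteDimensional ℂ V]
    (𝒜 : Finset (Submodule ℂ V)) (h𝒜 : ∀ A ∈ 𝒜, A ≠ ⊥) (r : ℕ) :
    ∃ b : Module.Basis (SubspaceModel.BasicIndex (SubspaceModel.sums 𝒜) r) ℚ
        (SubspaceModel.modelDegree (SubspaceModel.sums 𝒜) r),
      ∀ t, (b t : SubspaceModel.Model (SubspaceModel.sums 𝒜)) =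
        SubspaceModel.mu t.S t.T t.m := by
  have hsup := SubspaceModel.supClosed_sums 𝒜
  have hli := SubspaceModel.linearIndependent_mu hsup (SubspaceModel.ne_bot_of_mem_sums h𝒜) r
  have hspan : Submodule.span ℚ (Set.range
      fun t : SubspaceModel.BasicIndex (SubspaceModel.sums 𝒜) r => SubspaceModel.mu t.S t.T t.m) = SubspaceModel.modelDegree (SubspaceModel.sums 𝒜) r := by
    refine le_antisymm (Submodule.span_le.2 ?_)
      (SubspaceModel.modelDegree_le fun L s h => SubspaceModel.mon_mem_span hsup h)
    rintro _ ⟨t, rfl⟩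
    exact SubspaceModel.mu_mem_modelDegree t
  refine ⟨(Module.Basis.span hli).map (LinearEquiv.ofEq _ _ hspan), fun t => ?_⟩
  simp [Module.Basis.span_apply]
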